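/- Let $d,n\ge 1$ and let $A=(a_{hj})\in\mathbb N_0^{d\times n}$ have pairwise distinct columns. Suppose that the sum-of-products polynomial $f(w)=\sum_{j=1}^n\prod_{h=1}^d w_h^{a_{hj}}$ is non-negative on $\mathbb R^d$. Let $s\in\mathbb R^d$ with $s_h>0$ for all $h$, and let $|g(w)|=\prod_{h=1}^d|w_h|^{s_h-1}$. Let $W\subset\mathbb R^d$ be a sufficiently large compact set, that is, a compact set containing $[-M_0,M_0]^d$ for some $M_0>0$ that depends only on $A$ and $s$. Then the integral $$\zeta(z)=\int_W f(w)^z\,|g(w)|\,dw$$ converges absolutely for $\operatorname{Re}z>0$. Assume that $\zeta$ has a meromorphic continuation to $\mathbb C$. Then either the continuation has no pole, and we put $\lambda=\infty$ and $1/\lambda=0$, or it has a largest pole, that is, a real pole $-\lambda<0$ such that every pole $p$ satisfies $\operatorname{Re}p\le-\lambda$. Moreover $$\frac1\lambda\ \ge\ \max_{\alpha\in S_{d-1}}\ \min_{j=1,\dots,n}\ \sum_{h=1}^d\alpha_h\frac{a_{hj}}{s_h},\qquad S_{d-1}=\Big\{\alpha\in\mathbb R^d\ \Big|\ \alpha_h\ge0,\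 \sum_{h=1}^d\alpha_h=1\Big\}.$$ For $n=2$, the meromorphic continuation exists for every cube $W=[-M,M]^d$ with $M\ge M_0$, and for every $W$ as above for which $\zeta$ has a meromorphic continuation the inequality is an equality. In particular, put $$\nu_h=\frac{\max(a_{h1},a_{h2})}{s_h},\qquad \mu_h=\frac{\min(a_{h1},a_{h2})}{s_h},$$ $$H=\{(h,h')\in\{1,\dots,d\}^2 \mid (a_{h1}-a_{h2})(a_{h'1}-a_{h'2})<0\}.$$ Then $$\frac1\lambda=\max\left\{\max_{h}\mu_h,\ \max_{(h,h')\in H}\frac{\nu_h\nu_{h'}-\mu_h\mu_{h'}}{\nu_h+\nu_{h'}-\mu_h-\mu_{h'}}\right\},$$ where the second maximum is omitted if $H=\emptyset$. -/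

import Mathlib

open MeasureTheory Set
open scoped ENNReal

noncomputable section

/-- The sum-of-products polynomial `w ↦ ∑ j, ∏ h, w_h ^ a_{hj}` (all coefficients `1`) with
multi-index matrix `a`, as a function on `ℝ^d`. -/
def sopEval {d n : ℕ} (a : Fin d → Fin n → ℕ) (w : Fin d → ℝ) : ℝ :=
  ∑ j, ∏ h, w h ^ a h j

/-- The matrix `a` is the multi-index matrix of a non-negative sop polynomial: its columns are
pairwise distinct and the polynomial is non-negative on `ℝ^d`. -/
def IsNonnegSop {d n : ℕ} (a : Fin d → Fin n → ℕ) : Prop :=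
  (Function.Injective fun (j : Fin n) (h : Fin d) => a h j) ∧ ∀ w, 0 ≤ sopEval a w

/-- `|g(w)|` for the monomial `g(w) = w^{s-1} = ∏ h, w_h ^ (s_h - 1)`. -/
def absMonomial {d : ℕ} (s : Fin d → ℝ) (w : Fin d → ℝ) : ℝ :=
  ∏ h, |w h| ^ (s h - 1)

/-- The integrand `f(w)^z |g(w)|` of the zeta function. -/
def zetaIntegrand {d n : ℕ} (a : Fin d → Fin n → ℕ) (s : Fin d → ℝ) (z : ℂ)
    (w : Fin d → ℝ) : ℂ :=
  (sopEval a w : ℂ) ^ z * (absMonomial s w : ℂ)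

/-- The zeta function `ζ(z) = ∫_W f(w)^z |g(w)| dw`, to be used for `Re z > 0`. -/
def sopZeta {d n : ℕ} (a : Fin d → Fin n → ℕ) (s : Fin d → ℝ) (W : Set (Fin d → ℝ))
    (z : ℂ) : ℂ :=
  ∫ w in W, zetaIntegrand a s z w

/-- `F` is a meromorphic continuation to all of `ℂ` of the function `ζ` given on `Re z > 0`. -/
def IsMeromorphicContinuation (ζ F : ℂ → ℂ) : Prop :=
  (∀ z, MeromorphicAt F z) ∧ ∀ z : ℂ, 0 < z.re → F z = ζ z

/-- `F` has a pole at `p`. -/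
def IsPole (F : ℂ → ℂ) (p : ℂ) : Prop :=
  meromorphicOrderAt F p < 0

/-- `-lam` is the largest pole of `F`: it is a negative real pole, and no pole of `F` lies to the
right of it. By convention `lam = ∞` when `F` has no pole at all. -/
def IsLargestPole (F : ℂ → ℂ) (lam : ℝ≥0∞) : Prop :=
  (lam = ∞ ∧ ∀ p, ¬ IsPole F p) ∨
  ∃ l : ℝ, 0 < l ∧ lam = ENNReal.ofReal l ∧ IsPole F ((-l : ℝ) : ℂ) ∧ ∀ p, IsPole F p → p.re ≤ -l

/-- The values `min_j ∑_h α_h a_{hj} / s_h`, for `α` in the standard simplex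
`{α | α_h ≥ 0, ∑ α_h = 1}`. -/
def simplexValues {d n : ℕ} (a : Fin d → Fin n → ℕ) (s : Fin d → ℝ) : Set ℝ :=
  (fun α : Fin d → ℝ => ⨅ j, ∑ h, α h * ((a h j : ℝ) / s h)) '' stdSimplex ℝ (Fin d)

/-- `ν_h = max(a_{h1}, a_{h2}) / s_h`. -/
def nuIndex {d : ℕ} (a : Fin d → Fin 2 → ℕ) (s : Fin d → ℝ) (h : Fin d) : ℝ :=
  (max (a h 0) (a h 1) : ℝ) / s h

/-- `μ_h = min(a_{h1}, a_{h2}) / s_h`. -/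
def muIndex {d : ℕ} (a : Fin d → Fin 2 → ℕ) (s : Fin d → ℝ) (h : Fin d) : ℝ :=
  (min (a h 0) (a h 1) : ℝ) / s h

/-- The pairs of indices at which the two exponent vectors differ in opposite directions. -/
def oppositePairs {d : ℕ} (a : Fin d → Fin 2 → ℕ) : Set (Fin d × Fin d) :=
  {p | ((a p.1 0 : ℤ) - a p.1 1) * ((a p.2 0 : ℤ) - a p.2 1) < 0}

/-- The candidates for `1/λ` of a binomial: all `μ_h`, and
`(ν_h ν_{h'} - μ_h μ_{h'}) / (ν_h + ν_{h'} - μ_h - μ_{h'})` for the opposite pairs `(h, h')`. -/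
def binomialValues {d : ℕ} (a : Fin d → Fin 2 → ℕ) (s : Fin d → ℝ) : Set ℝ :=
  range (muIndex a s) ∪
  (fun p : Fin d × Fin d =>
    (nuIndex a s p.1 * nuIndex a s p.2 - muIndex a s p.1 * muIndex a s p.2) /
      (nuIndex a s p.1 + nuIndex a s p.2 - muIndex a s p.1 - muIndex a s p.2)) '' oppositePairs a

/-- The cube `[-M, M]^d`. -/
def cube (d : ℕ) (M : ℝ) : Set (Fin d → ℝ) :=
  Icc (fun _ => -M) (fun _ => M)

end

/-! With X = log f, which is finite almost everywhere, the zeta function is the exponential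
transform `complexMGF` of X for the finite measure |g| dw on W. As X is bounded above, the real t
with f^t |g| integrable form an up-closed set. To the right of its infimum σ the transform is
holomorphic, and Landau's positivity argument (`isPole_of_isGLB_integrableExpSet`) makes σ, when
finite, a pole of every meromorphic continuation. So -λ = σ, and 1/λ is decided by the convergence
of ∫ f^(-1/b) |g| (`exists_isLargestPole`). That σ < 0 follows from the local integrability of small
negative powers of a non-zero polynomial.

Lower bound (`not_integrableOn_of_lt`): the box with sides t^(α_h/s_h) has weight of order t, while
f ≤ n t^v on it, where v is the value of the minimum at α. Letting t → 0 forces divergence for b <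
v.

Equality for n = 2: non-negativity makes all exponents even, so weighted AM-GM bounds f below by a
monomial in |w| whose exponents are a θ-mixture of the two columns (`integrableOn_sopEval_rpow`).
The best θ matches the best α: this is the minimax theorem for a game with two columns, which also
yields the explicit formula (`exists_isGreatest_binomialValues`).

Continuation for n = 2: integration by parts along w_i ∂_i gives a linear relation between the two
halves of the integral, with a boundary term in one variable fewer
(`binomialIntegralPart_relation`). In an induction on d, one relation with equal coefficients or two
independent ones determine the integral. Otherwise both exponent vectors are proportional to s, and
a relation becomes a recursion in x that extends the integral by successive half-planes. -/

open Filter Topology ProbabilityTheory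

/-! ### Landau's theorem for exponential transforms -/

section Landau

/-- Identity theorem for meromorphic functions on a preconnected set. -/
theorem MeromorphicOn.eventuallyEq_of_frequently_eq {F G : ℂ → ℂ} {U : Set ℂ}
    (hF : MeromorphicOn F U) (hG : MeromorphicOn G U) (hU : IsPreconnected U) {x : ℂ} (hx : x ∈ U)
    (h : ∃ᶠ z in 𝓝[≠] x, F z = G z) {y : ℂ} (hy : y ∈ U) : F =ᶠ[𝓝[≠] y] G := by
  have hD : MeromorphicOn (F - G) U := hF.sub hG
  by_contra hne
  have h1 : meromorphicOrderAt (F - G) y ≠ ⊤ := by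
    intro h2
    rw [meromorphicOrderAt_eq_top_iff] at h2
    exact hne (h2.mono fun z hz => sub_eq_zero.1 hz)
  have h3 := hD.meromorphicOrderAt_ne_top_of_isPreconnected hU hy hx h1
  rw [meromorphicOrderAt_ne_top_iff_eventually_ne_zero (hD x hx)] at h3
  obtain ⟨z, hz1, hz2⟩ := (h.and_eventually h3).exists
  exact hz2 (sub_eq_zero.2 hz1)

variable {Ω : Type*} {mΩ : MeasurableSpace Ω} {X : Ω → ℝ} {μ : Measure Ω}

/-- From X ≤ B one gets e^(uX) ≤ e^(tX) e^((u-t)B), so convergence propagates to the right. -/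
theorem mem_integrableExpSet_of_le {B t u : ℝ} (hX : AEMeasurable X μ) (hB : ∀ᵐ ω ∂μ, X ω ≤ B)
    (ht : t ∈ integrableExpSet X μ) (htu : t ≤ u) : u ∈ integrableExpSet X μ := by
  have ht' : Integrable (fun ω => Real.exp (t * X ω)) μ := ht
  refine Integrable.mono' (ht'.mul_const (Real.exp ((u - t) * B)))
    (by fun_prop) (hB.mono fun ω hω => ?_)
  rw [Real.norm_eq_abs, Real.abs_exp, ← Real.exp_add]
  exact Real.exp_le_exp.2 (by nlinarith)

theorem mem_interior_integrableExpSet_of_lt {B t u : ℝ} (hX : AEMeasurable X μ)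
    (hB : ∀ᵐ ω ∂μ, X ω ≤ B) (ht : t ∈ integrableExpSet X μ) (htu : t < u) :
    u ∈ interior (integrableExpSet X μ) :=
  mem_interior.2 ⟨Ioi t, fun _ hv => mem_integrableExpSet_of_le hX hB ht (le_of_lt hv),
    isOpen_Ioi, htu⟩

theorem isPreconnected_re_gt (σ : ℝ) : IsPreconnected {z : ℂ | σ < z.re} :=
  (convex_halfSpace_re_gt σ).isPreconnected

theorem eventuallyEq_complexMGF {B t : ℝ} (hX : AEMeasurable X μ)
    (hB : ∀ᵐ ω ∂μ, X ω ≤ B) (ht : t ∈ integrableExpSet X μ) (ht0 : t < 0) {F : ℂ → ℂ}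
    (hF : ∀ z, MeromorphicAt F z) (hFX : ∀ z : ℂ, 0 < z.re → F z = complexMGF X μ z)
    {z : ℂ} (hz : t < z.re) : F =ᶠ[𝓝[≠] z] complexMGF X μ := by
  refine MeromorphicOn.eventuallyEq_of_frequently_eq (U := {z : ℂ | t < z.re})
    (fun z _ => hF z) (fun z hz => (analyticAt_complexMGF
      (mem_interior_integrableExpSet_of_lt hX hB ht hz)).meromorphicAt)
    -- The base point 1 lies in both half-planes because t < 0.
    (isPreconnected_re_gt t) (x := 1) (by simpa using by linarith) ?_ hz
  refine Eventually.frequently (eventually_nhdsWithin_of_eventually_nhds ?_)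
  have : {z : ℂ | 0 < z.re} ∈ 𝓝 (1 : ℂ) :=
    (isOpen_lt continuous_const Complex.continuous_re).mem_nhds (by simp)
  filter_upwards [this] with z hz using hFX z hz

theorem re_le_of_isPole {B t : ℝ} (hX : AEMeasurable X μ)
    (hB : ∀ᵐ ω ∂μ, X ω ≤ B) (ht : t ∈ integrableExpSet X μ) (ht0 : t < 0) {F : ℂ → ℂ}
    (hF : ∀ z, MeromorphicAt F z) (hFX : ∀ z : ℂ, 0 < z.re → F z = complexMGF X μ z)
    {p : ℂ} (hp : IsPole F p) : p.re ≤ t := by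
  by_contra! h
  have h1 := eventuallyEq_complexMGF hX hB ht ht0 hF hFX h
  unfold IsPole at hp
  rw [meromorphicOrderAt_congr h1] at hp
  exact absurd hp (not_lt.2 (analyticAt_complexMGF
    (mem_interior_integrableExpSet_of_lt hX hB ht h)).meromorphicOrderAt_nonneg)

/-- The positivity argument behind Landau's theorem: an exponential transform of a non-negative
random variable which extends holomorphically to a disc converges on that disc. -/
theorem integrable_exp_of_differentiableOn_ball {Y : Ω → ℝ} (hY : AEMeasurable Y μ)
    (hY0 : ∀ᵐ ω ∂μ, 0 ≤ Y ω) {c r ρ : ℝ} (hρ0 : 0 < ρ) (hρ : ρ < r)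
    (hc : -c ∈ interior (integrableExpSet Y μ)) {H : ℂ → ℂ}
    (hH : DifferentiableOn ℂ H (Metric.ball (c : ℂ) r))
    (hHY : ∀ᶠ z in 𝓝 (c : ℂ), H z = complexMGF Y μ (-z)) :
    Integrable (fun ω => Real.exp ((ρ - c) * Y ω)) μ := by
  have hmem : ((c - ρ : ℝ) : ℂ) ∈ Metric.ball (c : ℂ) r := by
    rw [Metric.mem_ball, Complex.dist_eq]
    push_cast
    rw [show (c - ρ - c : ℂ) = ((-ρ : ℝ) : ℂ) by push_cast; ring, Complex.norm_real]
    simpa [abs_of_pos hρ0] using hρ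
  have hsum := (Complex.hasSum_taylorSeries_on_ball hH hmem).summable
  -- The series is evaluated to the left of its centre: the sign (-1)^n of (-ρ)^n cancels the one
  -- from differentiating e^(-zY), so every term is non-negative.
  have hterm : ∀ n : ℕ, ((n.factorial : ℂ)⁻¹ • (((c - ρ : ℝ) : ℂ) - c) ^ n •
      iteratedDeriv n H c) =
      ((∫ ω, (ρ ^ n / n.factorial) * (Y ω ^ n * Real.exp (-c * Y ω)) ∂μ : ℝ) : ℂ) := by
    intro n
    have h1 : iteratedDeriv n H c = iteratedDeriv n (fun z => complexMGF Y μ (-z)) c :=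
      Filter.EventuallyEq.iteratedDeriv_eq n hHY
    rw [h1, iteratedDeriv_comp_neg, iteratedDeriv_complexMGF (by simpa using hc),
      integral_const_mul]
    have h2 : μ[fun ω => (Y ω : ℂ) ^ n * Complex.exp (-(c : ℂ) * Y ω)] =
        ((∫ ω, Y ω ^ n * Real.exp (-c * Y ω) ∂μ : ℝ) : ℂ) := by
      rw [← integral_complex_ofReal]
      congr 1
      ext ω
      push_cast
      rfl
    rw [h2]
    simp only [smul_eq_mul]
    push_cast
    rw [show (c - ρ - c : ℂ) = (-1) * ρ by ring, mul_pow]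
    have : ((-1 : ℂ) ^ n * (-1) ^ n) = 1 := by rw [← mul_pow]; simp
    linear_combination ((n.factorial : ℂ)⁻¹ * ρ ^ n *
      (∫ ω, Y ω ^ n * Real.exp (-c * Y ω) ∂μ : ℝ)) * this
  simp only [hterm] at hsum
  have hsum' := Complex.summable_ofReal.1 hsum
  set g : ℕ → Ω → ℝ := fun n ω => (ρ ^ n / n.factorial) * (Y ω ^ n * Real.exp (-c * Y ω)) with hg
  have hgi : ∀ n, Integrable (g n) μ := fun n =>
    (integrable_pow_mul_exp_of_mem_interior_integrableExpSet hc n).const_mul _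
  have hgn : ∀ n, ∀ᵐ ω ∂μ, 0 ≤ g n ω := fun n => hY0.mono fun ω hω => by
    simp only [hg]; positivity
  have hsumω : ∀ ω, HasSum (fun n => g n ω) (Real.exp ((ρ - c) * Y ω)) := by
    intro ω
    have h3 : HasSum (fun n => ((ρ * Y ω) ^ n / n.factorial) * Real.exp (-c * Y ω))
        (Real.exp (ρ * Y ω) * Real.exp (-c * Y ω)) := by
      refine HasSum.mul_right _ ?_
      rw [Real.exp_eq_exp_ℝ]
      exact NormedSpace.expSeries_div_hasSum_exp (ρ * Y ω)
    rw [← Real.exp_add, ← add_mul, ← sub_eq_add_neg] at h3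
    refine h3.congr_fun fun n => ?_
    simp only [hg, mul_pow]; ring
  refine ⟨by fun_prop, ?_⟩
  rw [hasFiniteIntegral_iff_ofReal (ae_of_all _ fun ω => (Real.exp_pos _).le)]
  -- By non-negativity, Tonelli exchanges sum and integral, and convergence of the Taylor series
  -- becomes integrability.
  have h4 : ∫⁻ ω, ENNReal.ofReal (Real.exp ((ρ - c) * Y ω)) ∂μ =
      ∫⁻ ω, ∑' n, ENNReal.ofReal (g n ω) ∂μ := by
    refine lintegral_congr_ae ((ae_all_iff.2 hgn).mono fun ω hω => ?_)
    dsimp only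
    rw [← (hsumω ω).tsum_eq, ENNReal.ofReal_tsum_of_nonneg hω (hsumω ω).summable]
  rw [h4, lintegral_tsum fun n => (hgi n).aemeasurable.ennreal_ofReal]
  simp_rw [← ofReal_integral_eq_lintegral_ofReal (hgi _) (hgn _)]
  rw [← ENNReal.ofReal_tsum_of_nonneg (fun n => integral_nonneg_of_ae (hgn n)) hsum']
  exact ENNReal.ofReal_lt_top

/-- **Landau's theorem**: the abscissa of convergence is a pole. -/
theorem isPole_of_isGLB_integrableExpSet {B σ : ℝ} (hX : AEMeasurable X μ)
    (hB : ∀ᵐ ω ∂μ, X ω ≤ B) (hσ : IsGLB (integrableExpSet X μ) σ) (hσ0 : σ < 0) {F : ℂ → ℂ}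
    (hF : ∀ z, MeromorphicAt F z) (hFX : ∀ z : ℂ, 0 < z.re → F z = complexMGF X μ z) :
    IsPole F (σ : ℂ) := by
  by_contra hp
  have hord : 0 ≤ meromorphicOrderAt F (σ : ℂ) := not_lt.1 hp
  have hmem : ∀ u, σ < u → u ∈ interior (integrableExpSet X μ) := by
    intro u hu
    obtain ⟨t, ht, _, htu⟩ := hσ.exists_between hu
    exact mem_interior_integrableExpSet_of_lt hX hB ht htu
  set G := toMeromorphicNFOn F univ with hG
  have hFU : MeromorphicOn F univ := fun z _ => hF z
  -- The normal form G removes the removable singularities of F, so that order ≥ 0 means analytic.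
  have hGN : ∀ z, MeromorphicNFAt G z := fun z =>
    meromorphicNFOn_toMeromorphicNFOn F univ (mem_univ z)
  have hGF : ∀ z, G =ᶠ[𝓝[≠] z] F := fun z =>
    hFU.toMeromorphicNFOn_eq_self_on_nhdsNE (mem_univ z)
  have hGmgf : ∀ z : ℂ, σ < z.re → G =ᶠ[𝓝 z] complexMGF X μ := by
    intro z hz
    have han := analyticAt_complexMGF (hmem z.re hz)
    rw [← MeromorphicNFAt.eventuallyEq_nhdsNE_iff_eventuallyEq_nhds (hGN z) han.meromorphicNFAt]
    refine (hGF z).trans ?_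
    obtain ⟨t, ht, _, htz⟩ := hσ.exists_between (lt_min hz hσ0)
    exact eventuallyEq_complexMGF hX hB ht (htz.trans_le (min_le_right _ _)) hF hFX
      (htz.trans_le (min_le_left _ _))
  have hGσ : AnalyticAt ℂ G σ := by
    rw [← (hGN σ).meromorphicOrderAt_nonneg_iff_analyticAt, meromorphicOrderAt_congr (hGF σ)]
    exact hord
  obtain ⟨r, hr, hGr⟩ := hGσ.exists_ball_analyticOnNhd
  -- The disc of radius r about c reaches σ - r/2. Its points with real part at most σ are nearer to
  -- σ than to c, hence lie in the disc where G is analytic.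
  set c : ℝ := σ + r / 2 with hc
  set Y : Ω → ℝ := fun ω => B - X ω with hYdef
  have hexp : ∀ t : ℝ, (fun ω => Real.exp (t * Y ω)) =
      fun ω => Real.exp (t * B) * Real.exp (-t * X ω) := by
    intro t; ext ω; rw [← Real.exp_add]; simp only [hYdef]; ring_nf
  have hYS : ∀ t : ℝ, t ∈ integrableExpSet Y μ ↔ -t ∈ integrableExpSet X μ := by
    intro t
    change Integrable _ μ ↔ Integrable _ μ
    rw [hexp, integrable_const_mul_iff]
    exact (Real.exp_pos _).ne'.isUnit
  have hcint : -c ∈ interior (integrableExpSet Y μ) := by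
    refine mem_interior.2 ⟨Iio (-σ), fun t ht => ?_, isOpen_Iio, ?_⟩
    · rw [hYS]
      exact interior_subset (hmem _ (by simp only [mem_Iio] at ht; linarith))
    · simp only [mem_Iio, hc]; linarith
  set H : ℂ → ℂ := fun z => Complex.exp (-z * B) * G z with hH
  have hHd : DifferentiableOn ℂ H (Metric.ball (c : ℂ) r) := by
    intro z hz
    have hGz : AnalyticAt ℂ G z := by
      rcases lt_or_ge σ z.re with h | h
      · exact (analyticAt_complexMGF (hmem z.re h)).congr (hGmgf z h).symm
      · refine hGr z ?_
        rw [Metric.mem_ball, Complex.dist_eq] at hz ⊢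
        refine lt_of_le_of_lt ?_ hz
        rw [Complex.norm_def, Complex.norm_def]
        refine Real.sqrt_le_sqrt ?_
        simp only [Complex.normSq_apply, Complex.sub_re, Complex.ofReal_re, Complex.sub_im,
          Complex.ofReal_im, hc]
        nlinarith
    have : DifferentiableAt ℂ H z :=
      DifferentiableAt.mul (by fun_prop) hGz.differentiableAt
    exact this.differentiableWithinAt
  have hHY : ∀ᶠ z in 𝓝 (c : ℂ), H z = complexMGF Y μ (-z) := by
    filter_upwards [hGmgf (c : ℂ) (by simp only [Complex.ofReal_re, hc]; linarith)] with z hz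
    simp only [hH, hz, complexMGF, ← integral_const_mul]
    congr 1
    ext ω
    rw [← Complex.exp_add]
    simp only [hYdef]
    push_cast
    ring_nf
  -- Here c - 3r/4 = σ - r/4, a point of convergence below the infimum.
  have hfin := integrable_exp_of_differentiableOn_ball (ρ := 3 * r / 4) (r := r) (hX.const_sub B)
    (hB.mono fun ω hω => sub_nonneg.2 hω) (by positivity) (by linarith) hcint hHd hHY
  have hin : (3 * r / 4 - c) ∈ integrableExpSet Y μ := hfin
  rw [hYS] at hin
  have := hσ.1 hin
  linarith

end Landau

/-! ### Cubes, Fubini in one coordinate, and integrable monomials -/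

section Cube

theorem isCompact_cube (d : ℕ) (M : ℝ) : IsCompact (cube d M) := isCompact_Icc

theorem measurableSet_cube (d : ℕ) (M : ℝ) : MeasurableSet (cube d M) := measurableSet_Icc

theorem cube_eq_pi (d : ℕ) (M : ℝ) : cube d M = Set.pi univ fun _ => Icc (-M) M :=
  (Set.pi_univ_Icc _ _).symm

theorem exists_subset_cube {d : ℕ} {W : Set (Fin d → ℝ)} (hW : IsCompact W) :
    ∃ M : ℝ, 1 ≤ M ∧ W ⊆ cube d M := by
  obtain ⟨R, hR⟩ := hW.isBounded.subset_closedBall 0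
  refine ⟨max R 1, le_max_right _ _, fun w hw => ?_⟩
  have h1 : ‖w‖ ≤ R := by simpa using hR hw
  have h2 : ∀ h, |w h| ≤ max R 1 := fun h => (norm_le_pi_norm w h).trans (h1.trans (le_max_left _ _))
  exact ⟨fun h => (abs_le.1 (h2 h)).1, fun h => (abs_le.1 (h2 h)).2⟩

theorem volume_restrict_cube (d : ℕ) (M : ℝ) : (volume : Measure (Fin d → ℝ)).restrict (cube d M) =
    Measure.pi fun _ => (volume : Measure ℝ).restrict (Icc (-M) M) := by
  rw [cube_eq_pi, volume_pi, Measure.restrict_pi_pi]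

theorem measurePreserving_insertNth_cube {d : ℕ} (M : ℝ) (i : Fin (d + 1)) :
    MeasurePreserving (fun q : ℝ × (Fin d → ℝ) => (i.insertNth q.1 q.2 : Fin (d + 1) → ℝ))
      ((volume.restrict (Icc (-M) M)).prod (volume.restrict (cube d M)))
      (volume.restrict (cube (d + 1) M)) := by
  rw [volume_restrict_cube, volume_restrict_cube]
  exact (measurePreserving_piFinSuccAbove
    (fun _ : Fin (d + 1) => (volume : Measure ℝ).restrict (Icc (-M) M)) i).symm _

theorem measurableEmbedding_insertNth {d : ℕ} (i : Fin (d + 1)) : MeasurableEmbedding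
    (fun q : ℝ × (Fin d → ℝ) => (i.insertNth q.1 q.2 : Fin (d + 1) → ℝ)) :=
  (MeasurableEquiv.piFinSuccAbove (fun _ : Fin (d + 1) => ℝ) i).symm.measurableEmbedding

theorem integrableOn_abs_rpow (M : ℝ) {r : ℝ} (hr : -1 < r) :
    IntegrableOn (fun t : ℝ => |t| ^ r) (Icc (-M) M) := by
  rcases lt_or_ge M 0 with hM | hM
  · rw [Icc_eq_empty (by linarith)]; exact integrableOn_empty
  have h1 : IntervalIntegrable (fun t : ℝ => |t| ^ r) volume 0 M :=
    (intervalIntegral.intervalIntegrable_rpow' hr).congr_uIoo fun t ht => by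
      rw [uIoo_of_le hM] at ht
      simp [abs_of_pos ht.1]
  have h2 : IntervalIntegrable (fun t : ℝ => |t| ^ r) volume (-M) 0 := by
    rw [IntervalIntegrable.iff_comp_neg]
    simpa using h1.symm
  exact (intervalIntegrable_iff_integrableOn_Icc_of_le (by linarith)).1 (h2.trans h1)

theorem integrableOn_prod_abs_rpow {d : ℕ} (M : ℝ) {r : Fin d → ℝ} (hr : ∀ h, -1 < r h) :
    IntegrableOn (fun w : Fin d → ℝ => ∏ h, |w h| ^ r h) (cube d M) := by
  rw [IntegrableOn, volume_restrict_cube]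
  exact Integrable.fintype_prod fun h => integrableOn_abs_rpow M (hr h)

theorem ae_forall_ne_zero {d : ℕ} : ∀ᵐ w : Fin d → ℝ, ∀ h, w h ≠ 0 := by
  rw [ae_all_iff]
  intro h
  rw [volume_pi]
  exact (Measure.tendsto_eval_ae_ae (μ := fun _ : Fin d => (volume : Measure ℝ)) (i := h)).eventually
    (Measure.ae_ne volume (0 : ℝ))

end Cube

/-! ### Local integrability of small negative powers of polynomials -/

section Polynomial

theorem ENNReal.rpow_neg_le_rpow_neg {x y : ℝ≥0∞} {r : ℝ} (hr : 0 ≤ r) (h : x ≤ y) :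
    y ^ (-r) ≤ x ^ (-r) := by
  rw [ENNReal.rpow_neg, ENNReal.rpow_neg]
  exact ENNReal.inv_le_inv.2 (ENNReal.rpow_le_rpow h hr)

/-- The bound is uniform in r: within distance 1 of r translation invariance applies, and elsewhere
the integrand is at most 1. -/
theorem exists_lintegral_enorm_sub_rpow_le (M : ℝ) {δ : ℝ} (h0 : 0 ≤ δ) (h1 : δ < 1) :
    ∃ K : ℝ≥0∞, K ≠ ∞ ∧ ∀ r : ℝ, ∫⁻ t in Icc (-M) M, ‖t - r‖ₑ ^ (-δ) ≤ K := by
  set g : ℝ → ℝ≥0∞ := (Icc (-1 : ℝ) 1).indicator fun t => ‖t‖ₑ ^ (-δ) with hg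
  have hgm : Measurable g := Measurable.indicator (by fun_prop) measurableSet_Icc
  have hgfin : ∫⁻ t, g t ≠ ∞ := by
    rw [hg, lintegral_indicator measurableSet_Icc]
    have h2 := (integrableOn_abs_rpow 1 (r := -δ) (by linarith)).2
    refine ne_of_lt (lt_of_le_of_lt (le_of_eq ?_) h2)
    refine lintegral_congr_ae (ae_restrict_of_ae ?_)
    filter_upwards [Measure.ae_ne volume (0 : ℝ)] with t ht
    rw [← ofReal_norm, ← ofReal_norm, ENNReal.ofReal_rpow_of_pos (norm_pos_iff.2 ht)]
    rw [Real.norm_eq_abs, Real.norm_of_nonneg (by positivity)]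
  refine ⟨volume (Icc (-M) M) + ∫⁻ t, g t, by simp [hgfin], fun r => ?_⟩
  calc ∫⁻ t in Icc (-M) M, ‖t - r‖ₑ ^ (-δ) ≤ ∫⁻ t in Icc (-M) M, (1 + g (t - r)) := by
        refine lintegral_mono fun t => ?_
        by_cases ht : t - r ∈ Icc (-1 : ℝ) 1
        · simp only [hg, indicator_of_mem ht]; exact le_add_self
        · simp only [hg, indicator_of_notMem ht, add_zero]
          have : (1 : ℝ≥0∞) ≤ ‖t - r‖ₑ := by
            rw [← ofReal_norm, ENNReal.one_le_ofReal, Real.norm_eq_abs]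
            by_contra! hlt
            exact ht ⟨(abs_lt.1 hlt).1.le, (abs_lt.1 hlt).2.le⟩
          calc ‖t - r‖ₑ ^ (-δ) ≤ 1 ^ (-δ) := ENNReal.rpow_neg_le_rpow_neg h0 this
            _ = 1 := ENNReal.one_rpow _
    _ = volume (Icc (-M) M) + ∫⁻ t in Icc (-M) M, g (t - r) := by
        rw [lintegral_add_left measurable_const]; simp
    _ ≤ volume (Icc (-M) M) + ∫⁻ t, g (t - r) := by gcongr; exact Measure.restrict_le_self
    _ = _ := by rw [lintegral_sub_right_eq_self g r]

/-- A product of D factors is at most the D-th power of the largest one; the summand 1 covers the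
empty product. -/
theorem Multiset.prod_map_le_one_add_sum {α : Type*} [DecidableEq α] (s : Multiset α)
    (f : α → ℝ≥0∞) {D : ℕ} (hD : s.card = D) :
    (s.map f).prod ≤ 1 + ∑ x ∈ s.toFinset, f x ^ D := by
  rcases s.toFinset.eq_empty_or_nonempty with h | h
  · rw [Multiset.toFinset_eq_empty] at h
    simp [h]
  · obtain ⟨x, hx, hmax⟩ := s.toFinset.exists_max_image f h
    calc (s.map f).prod ≤ f x ^ (s.map f).card := by
          refine Multiset.prod_le_pow_card _ _ fun y hy => ?_
          obtain ⟨x', hx', rfl⟩ := Multiset.mem_map.1 hy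
          exact hmax x' (Multiset.mem_toFinset.2 hx')
      _ = f x ^ D := by rw [Multiset.card_map, hD]
      _ ≤ ∑ x ∈ s.toFinset, f x ^ D := Finset.single_le_sum (f := fun x => f x ^ D)
          (fun _ _ => _root_.zero_le) hx
      _ ≤ _ := le_add_self

theorem ENNReal.multiset_prod_ne_top {s : Multiset ℝ≥0∞} (hs : ∀ x ∈ s, x ≠ ∞) : s.prod ≠ ∞ := by
  induction s using Multiset.induction with
  | empty => simp
  | cons a s ih =>
    rw [Multiset.prod_cons]
    exact ENNReal.mul_ne_top (hs a (Multiset.mem_cons_self a s))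
      (ih fun x hx => hs x (Multiset.mem_cons_of_mem hx))

theorem ENNReal.rpow_multiset_prod {s : Multiset ℝ≥0∞} (hs : ∀ x ∈ s, x ≠ ∞) (r : ℝ) :
    s.prod ^ r = (s.map fun x => x ^ r).prod := by
  induction s using Multiset.induction with
  | empty => simp
  | cons a s ih =>
    have h1 : ∀ x ∈ s, x ≠ ∞ := fun x hx => hs x (Multiset.mem_cons_of_mem hx)
    have h2 : s.prod ≠ ∞ := ENNReal.multiset_prod_ne_top h1
    rw [Multiset.prod_cons, Multiset.map_cons, Multiset.prod_cons,
      ENNReal.mul_rpow_of_ne_top (hs a (Multiset.mem_cons_self a s)) h2, ih h1]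

/-- Over ℂ the polynomial splits, and |t - r| ≥ |t - Re r| reduces each root to a real one. `K`
depends only on M, D and ε, so the leading coefficient can afterwards be integrated over the other
variables. -/
theorem exists_lintegral_polynomial_rpow_le (M : ℝ) (D : ℕ) {ε : ℝ} (h0 : 0 ≤ ε) (h1 : ε * D < 1) :
    ∃ K : ℝ≥0∞, K ≠ ∞ ∧ ∀ Q : Polynomial ℝ, Q.natDegree = D → Q ≠ 0 →
      ∫⁻ t in Icc (-M) M, ‖Q.eval t‖ₑ ^ (-ε) ≤ ‖Q.leadingCoeff‖ₑ ^ (-ε) * K := by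
  classical
  obtain ⟨K, hK, hKr⟩ := exists_lintegral_enorm_sub_rpow_le M (by positivity) h1
  refine ⟨volume (Icc (-M) M) + D * K, by
    simp [ENNReal.mul_eq_top, hK], fun Q hQ hQ0 => ?_⟩
  set P : Polynomial ℂ := Q.map Complex.ofRealHom with hP
  have hsp : P.Splits := IsAlgClosed.splits P
  have hlc : P.leadingCoeff = (Q.leadingCoeff : ℂ) := by
    rw [hP, Polynomial.leadingCoeff_map]; rfl
  have hcard : P.roots.card = D := by
    rw [← hsp.natDegree_eq_card_roots, hP, Polynomial.natDegree_map, hQ]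
  have hpt : ∀ t : ℝ, ‖Q.eval t‖ₑ ^ (-ε) ≤ ‖Q.leadingCoeff‖ₑ ^ (-ε) *
      (1 + ∑ r ∈ P.roots.toFinset, ‖t - r.re‖ₑ ^ (-(ε * D))) := by
    intro t
    have e1 : ‖Q.eval t‖ₑ = ‖P.eval (t : ℂ)‖ₑ := by
      rw [hP, ← Complex.ofRealHom_eq_coe, Polynomial.eval_map_apply]
      simp [← ofReal_norm]
    have e2 : ‖P.eval (t : ℂ)‖ₑ = ‖Q.leadingCoeff‖ₑ *
        (P.roots.map fun r => ‖(t : ℂ) - r‖ₑ).prod := by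
      rw [hsp.eval_eq_prod_roots, hlc, enorm_mul]
      congr 1
      · simp [← ofReal_norm]
      · induction P.roots using Multiset.induction with
        | empty => simp
        | cons a s ih => simp [enorm_mul, ih]
    have hne : ∀ x ∈ P.roots.map fun r => ‖(t : ℂ) - r‖ₑ, x ≠ ∞ := by
      intro x hx
      obtain ⟨r, _, rfl⟩ := Multiset.mem_map.1 hx
      exact enorm_ne_top
    rw [e1, e2, ENNReal.mul_rpow_of_ne_top enorm_ne_top
      (ENNReal.multiset_prod_ne_top hne),
      ENNReal.rpow_multiset_prod hne, Multiset.map_map]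
    gcongr
    refine (Multiset.prod_map_le_one_add_sum _ _ hcard).trans ?_
    gcongr with r _
    rw [Function.comp_apply, ← ENNReal.rpow_natCast, ← ENNReal.rpow_mul, neg_mul]
    refine ENNReal.rpow_neg_le_rpow_neg (by positivity) ?_
    rw [← ofReal_norm, ← ofReal_norm]
    refine ENNReal.ofReal_le_ofReal ?_
    simpa using Complex.abs_re_le_norm ((t : ℂ) - r)
  calc ∫⁻ t in Icc (-M) M, ‖Q.eval t‖ₑ ^ (-ε)
      ≤ ∫⁻ t in Icc (-M) M, ‖Q.leadingCoeff‖ₑ ^ (-ε) *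
        (1 + ∑ r ∈ P.roots.toFinset, ‖t - r.re‖ₑ ^ (-(ε * D))) := lintegral_mono hpt
    _ = ‖Q.leadingCoeff‖ₑ ^ (-ε) * (volume (Icc (-M) M) +
        ∑ r ∈ P.roots.toFinset, ∫⁻ t in Icc (-M) M, ‖t - r.re‖ₑ ^ (-(ε * D))) := by
        rw [lintegral_const_mul _ (by fun_prop), lintegral_add_left measurable_const,
          lintegral_finsetSum _ (by fun_prop)]
        simp
    _ ≤ ‖Q.leadingCoeff‖ₑ ^ (-ε) * (volume (Icc (-M) M) + D * K) := by
        gcongr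
        calc _ ≤ ∑ r ∈ P.roots.toFinset, K := Finset.sum_le_sum fun r _ => hKr r.re
          _ = (P.roots.toFinset.card : ℝ≥0∞) * K := by simp
          _ ≤ D * K := by
            gcongr
            exact hcard ▸ Multiset.toFinset_card_le _

theorem measurable_mvPolynomial_eval {d : ℕ} (p : MvPolynomial (Fin d) ℝ) :
    Measurable fun w : Fin d → ℝ => MvPolynomial.eval w p :=
  (MvPolynomial.continuous_eval p).measurable

/-- Small negative powers of a non-zero polynomial are locally integrable. -/
theorem exists_lintegral_mvPolynomial_rpow_lt_top (M : ℝ) {d : ℕ} (p : MvPolynomial (Fin d) ℝ)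
    (hp : p ≠ 0) : ∃ ε₀ : ℝ, 0 < ε₀ ∧ ∀ ε, 0 ≤ ε → ε ≤ ε₀ →
      ∫⁻ w in cube d M, ‖MvPolynomial.eval w p‖ₑ ^ (-ε) < ∞ := by
  induction d with
  | zero =>
    refine ⟨1, one_pos, fun ε _ _ => ?_⟩
    rw [MvPolynomial.eq_C_of_isEmpty p] at hp ⊢
    have hc : MvPolynomial.coeff 0 p ≠ 0 := fun h => hp (by rw [h, map_zero])
    simp only [MvPolynomial.eval_C, lintegral_const]
    refine ENNReal.mul_lt_top ?_ ?_
    · rw [lt_top_iff_ne_top, Ne, ENNReal.rpow_eq_top_iff]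
      simp [hc]
    · rw [Measure.restrict_apply_univ]
      exact (isCompact_cube _ _).measure_lt_top
  | succ d ih =>
    -- As a polynomial in the variable 0, p has a leading coefficient in d variables, to which the
    -- induction hypothesis applies.
    set q := MvPolynomial.finSuccEquiv ℝ d p with hq
    have hq0 : q ≠ 0 := by simpa [hq] using hp
    obtain ⟨ε₁, hε₁, hint⟩ := ih q.leadingCoeff (Polynomial.leadingCoeff_ne_zero.2 hq0)
    refine ⟨min ε₁ (1 / (q.natDegree + 1 : ℝ) / 2), by positivity, fun ε hε0 hε => ?_⟩
    have hεD : ε * q.natDegree < 1 := by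
      have h1 := hε.trans (min_le_right _ _)
      have h2 : (0 : ℝ) ≤ q.natDegree := by positivity
      calc ε * q.natDegree ≤ (1 / (q.natDegree + 1 : ℝ) / 2) * q.natDegree := by gcongr
        _ < 1 := by
          rw [div_div, div_mul_eq_mul_div, div_lt_one (by positivity)]; linarith
    obtain ⟨K, hK, hKQ⟩ := exists_lintegral_polynomial_rpow_le M q.natDegree hε0 hεD
    have hfin := hint ε hε0 (hε.trans (min_le_left _ _))
    -- A finite integral of a negative power excludes zeros on a set of positive measure, since 0 ^
    -- (-ε₁) = ∞.
    have hae : ∀ᵐ w ∂(volume.restrict (cube d M)), MvPolynomial.eval w q.leadingCoeff ≠ 0 := by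
      have h3 := ae_lt_top ((measurable_mvPolynomial_eval q.leadingCoeff).enorm.pow_const _)
        (hint ε₁ hε₁.le le_rfl).ne
      filter_upwards [h3] with w hw h0
      rw [h0] at hw
      simp [ENNReal.zero_rpow_of_neg (neg_lt_zero.2 hε₁)] at hw
    rw [← (measurePreserving_insertNth_cube M (0 : Fin (d + 1))).lintegral_comp_emb
      (measurableEmbedding_insertNth 0), lintegral_prod_symm]
    swap
    · exact (((measurable_mvPolynomial_eval p).comp
        (measurableEmbedding_insertNth 0).measurable).enorm.pow_const _).aemeasurable
    refine lt_of_le_of_lt (lintegral_mono_ae (g := fun w =>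
      ‖MvPolynomial.eval w q.leadingCoeff‖ₑ ^ (-ε) * K) ?_) ?_
    · filter_upwards [hae] with w hw
      simp only [Fin.insertNth_zero', MvPolynomial.eval_eq_eval_mv_eval']
      have h4 := Polynomial.leadingCoeff_map_of_leadingCoeff_ne_zero (MvPolynomial.eval w) hw
      have h5 := hKQ (Polynomial.map (MvPolynomial.eval w) q)
        (Polynomial.natDegree_map_of_leadingCoeff_ne_zero _ hw)
        (fun h0 => hw (by rw [← h4, h0, Polynomial.leadingCoeff_zero]))
      rw [h4] at h5
      exact h5
    · rw [lintegral_mul_const _ ((measurable_mvPolynomial_eval q.leadingCoeff).enorm.pow_const _)]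
      exact ENNReal.mul_lt_top hfin hK.lt_top

end Polynomial

/-! ### The zeta integral as an exponential transform -/

section WeightedMeasure

variable {d : ℕ} {s : Fin d → ℝ} {W : Set (Fin d → ℝ)} {f : (Fin d → ℝ) → ℝ}

/-- The measure `|g(w)| dw` on `W`. -/
noncomputable def monomialMeasure (s : Fin d → ℝ) (W : Set (Fin d → ℝ)) : Measure (Fin d → ℝ) :=
  (volume.restrict W).withDensity fun w => ENNReal.ofReal (absMonomial s w)

theorem absMonomial_nonneg (s : Fin d → ℝ) (w : Fin d → ℝ) : 0 ≤ absMonomial s w :=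
  Finset.prod_nonneg fun _ _ => Real.rpow_nonneg (abs_nonneg _) _

theorem measurable_absMonomial (s : Fin d → ℝ) : Measurable (absMonomial s) := by
  unfold absMonomial
  fun_prop

theorem measurable_ofReal_absMonomial (s : Fin d → ℝ) :
    Measurable fun w => ENNReal.ofReal (absMonomial s w) :=
  (measurable_absMonomial s).ennreal_ofReal

theorem integrableOn_absMonomial (hs : ∀ h, 0 < s h) (hW : IsCompact W) :
    IntegrableOn (absMonomial s) W := by
  obtain ⟨M, _, hM⟩ := exists_subset_cube hW
  exact (integrableOn_prod_abs_rpow M fun h => by linarith [hs h]).mono_set hM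

theorem integrable_monomialMeasure_iff {E : Type*} [NormedAddCommGroup E] [NormedSpace ℝ E]
    {φ : (Fin d → ℝ) → E} : Integrable φ (monomialMeasure s W) ↔
      IntegrableOn (fun w => absMonomial s w • φ w) W := by
  unfold monomialMeasure
  rw [integrable_withDensity_iff_integrable_smul' (measurable_ofReal_absMonomial s)
    (ae_of_all _ fun _ => ENNReal.ofReal_lt_top), IntegrableOn]
  simp only [ENNReal.toReal_ofReal (absMonomial_nonneg s _)]

theorem integral_monomialMeasure {E : Type*} [NormedAddCommGroup E] [NormedSpace ℝ E]
    (φ : (Fin d → ℝ) → E) : ∫ w, φ w ∂(monomialMeasure s W) =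
      ∫ w in W, absMonomial s w • φ w := by
  unfold monomialMeasure
  rw [integral_withDensity_eq_integral_toReal_smul (measurable_ofReal_absMonomial s)
    (ae_of_all _ fun _ => ENNReal.ofReal_lt_top)]
  simp only [ENNReal.toReal_ofReal (absMonomial_nonneg s _)]

theorem ae_monomialMeasure {P : (Fin d → ℝ) → Prop} (h : ∀ᵐ w ∂(volume.restrict W), P w) :
    ∀ᵐ w ∂(monomialMeasure s W), P w :=
  (withDensity_absolutelyContinuous _ _).ae_le h

theorem mem_integrableExpSet_log_iff (hf : ∀ᵐ w ∂(volume.restrict W), 0 < f w) {t : ℝ} :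
    t ∈ integrableExpSet (fun w => Real.log (f w)) (monomialMeasure s W) ↔
      IntegrableOn (fun w => f w ^ t * absMonomial s w) W := by
  change Integrable _ _ ↔ _
  rw [integrable_monomialMeasure_iff]
  refine integrable_congr (hf.mono fun w hw => ?_)
  dsimp only
  rw [smul_eq_mul, mul_comm, Real.rpow_def_of_pos hw, mul_comm t]

theorem smul_cexp_log_eq {x y : ℝ} (hx : 0 < x) (z : ℂ) :
    y • Complex.exp (z * (Real.log x : ℂ)) = (x : ℂ) ^ z * (y : ℂ) := by
  rw [Complex.cpow_def_of_ne_zero (by exact_mod_cast hx.ne'), Complex.real_smul,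
    ← Complex.ofReal_log hx.le, mul_comm, mul_comm z]

theorem complexMGF_log (hf : ∀ᵐ w ∂(volume.restrict W), 0 < f w) (z : ℂ) :
    complexMGF (fun w => Real.log (f w)) (monomialMeasure s W) z =
      ∫ w in W, (f w : ℂ) ^ z * (absMonomial s w : ℂ) := by
  rw [complexMGF, integral_monomialMeasure]
  exact integral_congr_ae (hf.mono fun w hw => smul_cexp_log_eq hw z)

theorem integrable_cexp_log_iff (hf : ∀ᵐ w ∂(volume.restrict W), 0 < f w) (z : ℂ) :
    Integrable (fun w => Complex.exp (z * (Real.log (f w) : ℂ))) (monomialMeasure s W) ↔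
      IntegrableOn (fun w => (f w : ℂ) ^ z * (absMonomial s w : ℂ)) W := by
  rw [integrable_monomialMeasure_iff]
  exact integrable_congr (hf.mono fun w hw => smul_cexp_log_eq hw z)

theorem isFiniteMeasure_monomialMeasure (hs : ∀ h, 0 < s h) (hW : IsCompact W) :
    IsFiniteMeasure (monomialMeasure s W) :=
  isFiniteMeasure_withDensity_ofReal (integrableOn_absMonomial hs hW).2

theorem zero_mem_integrableExpSet (hs : ∀ h, 0 < s h) (hW : IsCompact W)
    (X : (Fin d → ℝ) → ℝ) : (0 : ℝ) ∈ integrableExpSet X (monomialMeasure s W) := by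
  have := isFiniteMeasure_monomialMeasure hs hW
  simp [integrableExpSet]

end WeightedMeasure

/-! ### From the abscissa of convergence to the largest pole -/

section LargestPole

/-- The largest pole of the continuation of an exponential transform is governed by the abscissa
of convergence. -/
theorem exists_isLargestPole {Ω : Type*} {mΩ : MeasurableSpace Ω} {X : Ω → ℝ} {μ : Measure Ω}
    {B t₀ : ℝ} (hX : AEMeasurable X μ) (hB : ∀ᵐ ω ∂μ, X ω ≤ B) (ht₀ : t₀ ∈ integrableExpSet X μ)
    (ht₀' : t₀ < 0) {F : ℂ → ℂ}
    (hF : ∀ z, MeromorphicAt F z) (hFX : ∀ z : ℂ, 0 < z.re → F z = complexMGF X μ z) :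
    ∃ lam : ℝ≥0∞, IsLargestPole F lam ∧ ∀ b : ℝ, 0 < b →
      (-b⁻¹ ∈ integrableExpSet X μ → 1 / lam ≤ ENNReal.ofReal b) ∧
      (-b⁻¹ ∉ integrableExpSet X μ → ENNReal.ofReal b ≤ 1 / lam) := by
  by_cases hbdd : BddBelow (integrableExpSet X μ)
  · have hglb := isGLB_csInf ⟨t₀, ht₀⟩ hbdd
    set σ := sInf (integrableExpSet X μ)
    have hσ : σ < 0 := (hglb.1 ht₀).trans_lt ht₀'
    have hσ' : 0 < -σ := neg_pos.2 hσ
    refine ⟨ENNReal.ofReal (-σ), Or.inr ⟨-σ, hσ', rfl, ?_, fun p hp => ?_⟩, fun b hb => ?_⟩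
    · rw [neg_neg]
      exact isPole_of_isGLB_integrableExpSet hX hB hglb hσ hF hFX
    · rw [neg_neg]
      refine hglb.2 fun t ht => ?_
      rcases lt_or_ge t 0 with h | h
      · exact re_le_of_isPole hX hB ht h hF hFX hp
      · exact (re_le_of_isPole hX hB ht₀ ht₀' hF hFX hp).trans (ht₀'.le.trans h)
    · rw [one_div, ← ENNReal.ofReal_inv_of_pos hσ']
      refine ⟨fun h => ENNReal.ofReal_le_ofReal ?_, fun h => ENNReal.ofReal_le_ofReal ?_⟩
      · have := hglb.1 h
        exact inv_le_of_inv_le₀ hb (by linarith)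
      · have : -b⁻¹ ≤ σ := by
          by_contra! hlt
          obtain ⟨t, ht, _, htb⟩ := hglb.exists_between hlt
          exact h (mem_integrableExpSet_of_le hX hB ht htb.le)
        exact le_inv_of_le_inv₀ hσ' (by linarith)
  -- With no lower bound the transform converges everywhere and any continuation is free of poles:
  -- the case λ = ∞.
  · have hall : ∀ t, t ∈ integrableExpSet X μ := fun t => by
      obtain ⟨u, hu, hut⟩ := not_bddBelow_iff.1 hbdd t
      exact mem_integrableExpSet_of_le hX hB hu hut.le
    refine ⟨∞, Or.inl ⟨rfl, fun p hp => ?_⟩, fun b _ => ⟨fun _ => by simp, fun h => (h (hall _)).elim⟩⟩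
    have h1 : min (p.re - 1) (-1) < 0 := (min_le_right _ _).trans_lt (by norm_num)
    have := (re_le_of_isPole hX hB (hall _) h1 hF hFX hp).trans (min_le_left _ _)
    linarith

end LargestPole

/-! ### Sop polynomials: negative abscissa and the lower bound for 1/λ -/

section Sop

variable {d n : ℕ} {a : Fin d → Fin n → ℕ} {s : Fin d → ℝ} {W : Set (Fin d → ℝ)}

theorem continuous_sopEval (a : Fin d → Fin n → ℕ) : Continuous (sopEval a) := by
  unfold sopEval
  fun_prop

theorem exists_eval_eq_sopEval (hn : 0 < n) (a : Fin d → Fin n → ℕ) :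
    ∃ p : MvPolynomial (Fin d) ℝ, p ≠ 0 ∧ ∀ w, MvPolynomial.eval w p = sopEval a w := by
  have h : ∀ w, MvPolynomial.eval w (∑ j, ∏ h, (MvPolynomial.X h : MvPolynomial (Fin d) ℝ) ^ a h j) =
      sopEval a w := fun w => by simp [sopEval]
  refine ⟨_, fun h0 => ?_, h⟩
  -- The value at (1, …, 1) is n, which is not 0.
  have h1 := h fun _ => 1
  rw [h0] at h1
  simp only [map_zero, sopEval, one_pow, Finset.prod_const_one, Finset.sum_const, Finset.card_univ,
    Fintype.card_fin, nsmul_eq_mul, mul_one] at h1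
  exact hn.ne (by exact_mod_cast h1)

theorem exists_lintegral_sopEval_rpow_lt_top (hn : 0 < n) (a : Fin d → Fin n → ℕ)
    (hW : IsCompact W) : ∃ ε : ℝ, 0 < ε ∧ ∫⁻ w in W, ‖sopEval a w‖ₑ ^ (-ε) < ∞ := by
  obtain ⟨M, _, hM⟩ := exists_subset_cube hW
  obtain ⟨p, hp, hpe⟩ := exists_eval_eq_sopEval hn a
  obtain ⟨ε, hε, h⟩ := exists_lintegral_mvPolynomial_rpow_lt_top M p hp
  have h1 := h ε hε.le le_rfl
  simp only [hpe] at h1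
  exact ⟨ε, hε, (lintegral_mono_set hM).trans_lt h1⟩

theorem ae_sopEval_pos (hn : 0 < n) (ha : IsNonnegSop a) (hW : IsCompact W) :
    ∀ᵐ w ∂(volume.restrict W), 0 < sopEval a w := by
  obtain ⟨ε, hε, h⟩ := exists_lintegral_sopEval_rpow_lt_top hn a hW
  filter_upwards [ae_lt_top ((continuous_sopEval a).measurable.enorm.pow_const _) h.ne] with w hw
  refine lt_of_le_of_ne (ha.2 w) fun h0 => ?_
  rw [← h0] at hw
  simp [ENNReal.zero_rpow_of_neg (neg_lt_zero.2 hε)] at hw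

/-- The condition s_h - 1 > -1 is open, so it survives multiplication by some p slightly above 1. -/
theorem exists_one_lt_integrable_absMonomial_rpow (hs : ∀ h, 0 < s h) (hW : IsCompact W) :
    ∃ p : ℝ, 1 < p ∧ IntegrableOn (fun w => absMonomial s w ^ p) W := by
  have h1 : ∀ h, ∀ᶠ p in 𝓝[>] (1 : ℝ), -1 < (s h - 1) * p := fun h => by
    refine eventually_nhdsWithin_of_eventually_nhds ?_
    have hc : Continuous fun p : ℝ => (s h - 1) * p := by fun_prop
    exact hc.continuousAt.eventually (lt_mem_nhds (by linarith [hs h]))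
  obtain ⟨p, hp, hp1⟩ := ((eventually_all.2 h1).and self_mem_nhdsWithin).exists
  refine ⟨p, hp1, ?_⟩
  obtain ⟨M, _, hM⟩ := exists_subset_cube hW
  refine ((integrableOn_prod_abs_rpow M hp).mono_set hM).congr_fun_ae (ae_of_all _ fun w => ?_)
  dsimp only [absMonomial]
  rw [← Real.finsetProd_rpow _ _ fun h _ => Real.rpow_nonneg (abs_nonneg _) _]
  simp only [← Real.rpow_mul (abs_nonneg _)]

/-- This makes the abscissa strictly negative. Young's inequality separates the factors: f^(-ε/q)
|g| ≤ f^(-ε)/q + |g|^p/p. -/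
theorem exists_neg_mem_integrableExpSet (hn : 0 < n) (ha : IsNonnegSop a) (hs : ∀ h, 0 < s h)
    (hW : IsCompact W) : ∃ t : ℝ, t < 0 ∧
      t ∈ integrableExpSet (fun w => Real.log (sopEval a w)) (monomialMeasure s W) := by
  have hpos := ae_sopEval_pos hn ha hW
  obtain ⟨ε, hε, hfin⟩ := exists_lintegral_sopEval_rpow_lt_top hn a hW
  obtain ⟨p, hp, hpint⟩ := exists_one_lt_integrable_absMonomial_rpow hs hW
  have hpq := Real.HolderConjugate.conjExponent hp
  set q := p.conjExponent
  refine ⟨-(ε / q), neg_lt_zero.2 (div_pos hε hpq.symm.pos), ?_⟩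
  rw [mem_integrableExpSet_log_iff hpos]
  have hmf := (continuous_sopEval a).measurable
  have hfint : IntegrableOn (fun w => sopEval a w ^ (-ε)) W := by
    refine ⟨(hmf.pow_const _).aestronglyMeasurable, ?_⟩
    refine lt_of_le_of_lt (le_of_eq ?_) hfin
    refine lintegral_congr_ae (hpos.mono fun w hw => ?_)
    dsimp only
    rw [← ofReal_norm, ← ofReal_norm, ENNReal.ofReal_rpow_of_pos (norm_pos_iff.2 hw.ne'),
      Real.norm_of_nonneg hw.le, Real.norm_of_nonneg (by positivity)]
  refine Integrable.mono' ((hfint.div_const q).add (hpint.div_const p))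
    ((hmf.pow_const _).mul (measurable_absMonomial s)).aestronglyMeasurable
    (hpos.mono fun w hw => ?_)
  have h1 := Real.young_inequality_of_nonneg (Real.rpow_nonneg hw.le (-(ε / q)))
    (absMonomial_nonneg s w) hpq.symm
  rw [← Real.rpow_mul hw.le, neg_mul, div_mul_cancel₀ _ hpq.symm.pos.ne'] at h1
  rw [Real.norm_of_nonneg (mul_nonneg (Real.rpow_nonneg hw.le _) (absMonomial_nonneg s w))]
  exact h1

theorem aemeasurable_log_sopEval (a : Fin d → Fin n → ℕ) (μ : Measure (Fin d → ℝ)) :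
    AEMeasurable (fun w => Real.log (sopEval a w)) μ :=
  (continuous_sopEval a).measurable.log.aemeasurable

theorem exists_log_sopEval_le (hn : 0 < n) (ha : IsNonnegSop a) (hW : IsCompact W) (s : Fin d → ℝ) :
    ∃ B : ℝ, ∀ᵐ w ∂(monomialMeasure s W), Real.log (sopEval a w) ≤ B := by
  obtain ⟨C, hC⟩ := hW.bddAbove_image (continuous_sopEval a).continuousOn
  refine ⟨Real.log C, ae_monomialMeasure ?_⟩
  filter_upwards [ae_sopEval_pos hn ha hW, ae_restrict_mem hW.measurableSet] with w hw hwW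
  exact Real.log_le_log hw (hC (mem_image_of_mem _ hwW))

theorem integrableOn_zetaIntegrand (hn : 0 < n) (ha : IsNonnegSop a) (hs : ∀ h, 0 < s h)
    (hW : IsCompact W) {z : ℂ} (hz : 0 < z.re) : IntegrableOn (zetaIntegrand a s z) W := by
  obtain ⟨B, hB⟩ := exists_log_sopEval_le hn ha hW s
  exact (integrable_cexp_log_iff (ae_sopEval_pos hn ha hW) z).1
    (integrable_cexp_mul_of_re_mem_integrableExpSet (aemeasurable_log_sopEval a _)
      (mem_integrableExpSet_of_le (aemeasurable_log_sopEval a _) hB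
        (zero_mem_integrableExpSet hs hW _) hz.le))

theorem exists_isLargestPole_sopZeta (hn : 0 < n) (ha : IsNonnegSop a) (hs : ∀ h, 0 < s h)
    (hW : IsCompact W) {F : ℂ → ℂ} (hF : IsMeromorphicContinuation (sopZeta a s W) F) :
    ∃ lam : ℝ≥0∞, IsLargestPole F lam ∧ ∀ b : ℝ, 0 < b →
      (IntegrableOn (fun w => sopEval a w ^ (-b⁻¹) * absMonomial s w) W →
        1 / lam ≤ ENNReal.ofReal b) ∧
      (¬ IntegrableOn (fun w => sopEval a w ^ (-b⁻¹) * absMonomial s w) W →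
        ENNReal.ofReal b ≤ 1 / lam) := by
  obtain ⟨B, hB⟩ := exists_log_sopEval_le hn ha hW s
  obtain ⟨t, ht0, ht⟩ := exists_neg_mem_integrableExpSet hn ha hs hW
  have hpos := ae_sopEval_pos hn ha hW
  simp_rw [← mem_integrableExpSet_log_iff (s := s) hpos]
  exact exists_isLargestPole (aemeasurable_log_sopEval a _) hB ht ht0 hF.1
    fun z hz => (hF.2 z hz).trans (complexMGF_log hpos z).symm

/-- The integral of the weight over the box `∏ (0, t ^ (α_h / s_h)]`. -/
theorem integral_absMonomial_box (hs : ∀ h, 0 < s h) {α : Fin d → ℝ} (hα : ∑ h, α h = 1) {t : ℝ}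
    (ht : 0 < t) : ∫ w in Set.pi univ fun h => Ioc 0 (t ^ (α h / s h)), absMonomial s w =
      t * ∏ h, (s h)⁻¹ := by
  rw [volume_pi, Measure.restrict_pi_pi]
  unfold absMonomial
  rw [integral_fintype_prod_eq_prod (fun h x => |x| ^ (s h - 1))]
  have h1 : ∀ h, ∫ x in Ioc 0 (t ^ (α h / s h)), |x| ^ (s h - 1) = t ^ α h * (s h)⁻¹ := by
    intro h
    have h2 : ∫ x in Ioc 0 (t ^ (α h / s h)), |x| ^ (s h - 1) =
        ∫ x in Ioc 0 (t ^ (α h / s h)), x ^ (s h - 1) :=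
      setIntegral_congr_fun measurableSet_Ioc fun x hx => by
        rw [abs_of_pos hx.1]
    rw [h2, ← intervalIntegral.integral_of_le (by positivity),
      integral_rpow (Or.inl (by linarith [hs h])), sub_add_cancel, Real.zero_rpow (hs h).ne',
      ← Real.rpow_mul ht.le, div_mul_cancel₀ _ (hs h).ne', sub_zero, div_eq_mul_inv]
  rw [Finset.prod_congr rfl fun h _ => h1 h, Finset.prod_mul_distrib, ← Real.rpow_sum_of_pos ht, hα,
    Real.rpow_one]

theorem sopEval_le_on_box {α : Fin d → ℝ} {v t : ℝ} (ht : 0 < t) (ht1 : t ≤ 1)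
    (hv : ∀ j, v ≤ ∑ h, α h * ((a h j : ℝ) / s h)) {w : Fin d → ℝ}
    (hw : ∀ h, 0 < w h ∧ w h ≤ t ^ (α h / s h)) : sopEval a w ≤ n * t ^ v := by
  unfold sopEval
  calc ∑ j, ∏ h, w h ^ a h j ≤ ∑ j : Fin n, t ^ v := by
        refine Finset.sum_le_sum fun j _ => ?_
        calc ∏ h, w h ^ a h j ≤ ∏ h, t ^ (α h * ((a h j : ℝ) / s h)) := by
              refine Finset.prod_le_prod (fun h _ => pow_nonneg (hw h).1.le _) fun h _ => ?_
              calc w h ^ a h j ≤ (t ^ (α h / s h)) ^ a h j := pow_le_pow_left₀ (hw h).1.le (hw h).2 _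
                _ = t ^ (α h * ((a h j : ℝ) / s h)) := by
                  rw [← Real.rpow_natCast, ← Real.rpow_mul ht.le]; congr 1; ring
          _ = t ^ ∑ h, α h * ((a h j : ℝ) / s h) := (Real.rpow_sum_of_pos ht _ _).symm
          _ ≤ t ^ v := Real.rpow_le_rpow_of_exponent_ge ht ht1 (hv j)
    _ = n * t ^ v := by simp

/-- The box of parameter t contributes at least (n t^v)^(-1/b) times its weight t ∏ 1/s_h, that is C
t^(1 - v/b). The exponent is negative, so no finite integral dominates this as t → 0. -/
theorem not_integrableOn_of_lt (hn : 0 < n) (hs : ∀ h, 0 < s h) (hW : cube d 1 ⊆ W)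
    {α : Fin d → ℝ} (hα : α ∈ stdSimplex ℝ (Fin d)) {v b : ℝ} (hb : 0 < b) (hbv : b < v)
    (hv : ∀ j, v ≤ ∑ h, α h * ((a h j : ℝ) / s h)) (hpos : ∀ w, 0 ≤ sopEval a w) :
    ¬ IntegrableOn (fun w => sopEval a w ^ (-b⁻¹) * absMonomial s w) W := by
  intro hint
  have hn' : (0 : ℝ) < n := by exact_mod_cast hn
  set I := ∫ w in cube d 1, sopEval a w ^ (-b⁻¹) * absMonomial s w with hI
  have hint1 := hint.mono_set hW
  set C := (n : ℝ) ^ (-b⁻¹) * ∏ h, (s h)⁻¹ with hC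
  have hCpos : 0 < C := mul_pos (Real.rpow_pos_of_pos hn' _) (Finset.prod_pos fun h _ => inv_pos.2 (hs h))
  have hbound : ∀ t : ℝ, 0 < t → t ≤ 1 → C * t ^ (1 - v / b) ≤ I := by
    intro t ht ht1
    set box : Set (Fin d → ℝ) := Set.pi univ fun h => Ioc 0 (t ^ (α h / s h)) with hbox
    have hboxm : MeasurableSet box := MeasurableSet.univ_pi fun h => measurableSet_Ioc
    have hsub : box ⊆ cube d 1 := by
      rw [cube_eq_pi]
      refine Set.pi_mono fun h _ x hx => ⟨by linarith [hx.1], hx.2.trans ?_⟩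
      exact Real.rpow_le_one ht.le ht1 (div_nonneg (hα.1 h) (hs h).le)
    calc C * t ^ (1 - v / b) = ∫ w in box, (n * t ^ v) ^ (-b⁻¹) * absMonomial s w := by
          rw [integral_const_mul, integral_absMonomial_box hs hα.2 ht, hC,
            Real.mul_rpow hn'.le (by positivity), ← Real.rpow_mul ht.le, sub_eq_add_neg,
            Real.rpow_add ht, Real.rpow_one, mul_neg, ← div_eq_mul_inv]
          ring
      _ ≤ ∫ w in box, sopEval a w ^ (-b⁻¹) * absMonomial s w := by
          refine setIntegral_mono_on ?_ (hint1.mono_set hsub) hboxm fun w hw => ?_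
          · exact ((integrableOn_absMonomial hs (isCompact_cube d 1)).mono_set hsub).const_mul _
          · have hw' : ∀ h, 0 < w h ∧ w h ≤ t ^ (α h / s h) := fun h => hw h (mem_univ h)
            refine mul_le_mul_of_nonneg_right ?_ (absMonomial_nonneg s w)
            refine Real.rpow_le_rpow_of_nonpos ?_ (sopEval_le_on_box ht ht1 hv hw')
              (neg_nonpos.2 (inv_pos.2 hb).le)
            exact Finset.sum_pos (fun j _ => Finset.prod_pos fun h _ => pow_pos (hw' h).1 _)
              ⟨⟨0, hn⟩, Finset.mem_univ _⟩
      _ ≤ I := setIntegral_mono_set hint1 (ae_of_all _ fun w => mul_nonneg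
          (Real.rpow_nonneg (hpos w) _) (absMonomial_nonneg s w)) (ae_of_all _ hsub)
  have hexp : 1 - v / b < 0 := by rw [sub_neg, one_lt_div hb]; exact hbv
  have htend := (tendsto_rpow_neg_nhdsGT_zero hexp).const_mul_atTop hCpos
  have hev : ∀ᶠ t : ℝ in 𝓝[>] 0, t ≤ 1 := eventually_nhdsWithin_of_eventually_nhds
    (eventually_le_nhds one_pos)
  obtain ⟨t, ⟨h1, h2⟩, h3⟩ := ((htend.eventually_gt_atTop I).and hev).and self_mem_nhdsWithin |>.exists
  exact absurd (hbound t h3 h2) (not_le.2 h1)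

theorem exists_isGreatest_simplexValues (hd : 0 < d) (hn : 0 < n) (a : Fin d → Fin n → ℕ)
    (s : Fin d → ℝ) : ∃ β, IsGreatest (simplexValues a s) β := by
  have := Fin.pos_iff_nonempty.1 hd
  have := Fin.pos_iff_nonempty.1 hn
  refine ((isCompact_stdSimplex ℝ (Fin d)).image ?_).exists_isGreatest ?_
  · have : (fun α : Fin d → ℝ => ⨅ j, ∑ h, α h * ((a h j : ℝ) / s h)) = fun α : Fin d → ℝ =>
        Finset.univ.inf' Finset.univ_nonempty fun j => ∑ h, α h * ((a h j : ℝ) / s h) := by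
      ext α
      rw [Finset.inf'_univ_eq_ciInf]
    rw [this]
    exact Continuous.finset_inf'_apply _ fun j _ => by fun_prop
  · exact Set.Nonempty.image _ ⟨_, single_mem_stdSimplex ℝ (Classical.arbitrary (Fin d))⟩

/-- Divergence is known only for b strictly below the value at α, hence the limit of b from below.
-/
theorem ofReal_le_one_div_of_isLargestPole (hn : 0 < n) (hs : ∀ h, 0 < s h) (ha : IsNonnegSop a)
    (hW : cube d 1 ⊆ W) {β : ℝ} (hβ : β ∈ simplexValues a s) {lam : ℝ≥0∞}
    (hlam : ∀ b : ℝ, 0 < b →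
      ¬ IntegrableOn (fun w => sopEval a w ^ (-b⁻¹) * absMonomial s w) W →
        ENNReal.ofReal b ≤ 1 / lam) : ENNReal.ofReal β ≤ 1 / lam := by
  obtain ⟨α, hα, rfl⟩ := hβ
  dsimp only
  refine le_of_forall_lt fun c hc => ?_
  obtain ⟨b, hb1, hb2⟩ := exists_between hc
  have hbt : b ≠ ∞ := hb2.ne_top
  have hbpos : 0 < b.toReal := ENNReal.toReal_pos (pos_of_gt hb1).ne' hbt
  refine hb1.trans_le ?_
  rw [← ENNReal.ofReal_toReal hbt]
  refine hlam _ hbpos (not_integrableOn_of_lt hn hs hW hα hbpos ?_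
    (fun j => ciInf_le (Set.finite_range _).bddBelow j) ha.2)
  rw [← ENNReal.ofReal_toReal hbt] at hb2
  exact (ENNReal.ofReal_lt_ofReal_iff_of_nonneg hbpos.le).1 hb2

end Sop

/-! ### Binomials: the matching upper bound and the minimax identity -/

section Binomial

variable {d : ℕ} {a : Fin d → Fin 2 → ℕ} {s : Fin d → ℝ} {W : Set (Fin d → ℝ)}

theorem even_of_isNonnegSop (ha : IsNonnegSop a) (h₀ : Fin d) (j : Fin 2) : Even (a h₀ j) := by
  by_contra hodd
  rw [Nat.not_even_iff_odd] at hodd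
  obtain ⟨j', hj', huniv⟩ : ∃ j' : Fin 2, j' ≠ j ∧ ∀ φ : Fin 2 → ℝ, ∑ i, φ i = φ j + φ j' := by
    fin_cases j
    · exact ⟨1, by decide, fun φ => by simp⟩
    · exact ⟨0, by decide, fun φ => by simp [add_comm]⟩
  obtain ⟨k, hk⟩ : ∃ k, a k j ≠ a k j' := by
    by_contra! hall
    exact hj' (ha.1 (funext fun h => (hall h).symm))
  obtain ⟨c, hc0, hc⟩ : ∃ c : ℝ, 0 < c ∧ c ^ a k j' < c ^ a k j := by
    rcases lt_or_gt_of_ne hk with h | h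
    · exact ⟨1 / 2, by norm_num, pow_lt_pow_right_of_lt_one₀ (by norm_num) (by norm_num) h⟩
    · exact ⟨2, by norm_num, pow_lt_pow_right₀ (by norm_num) h⟩
  -- Flipping the sign of coordinate h₀ makes the odd monomial negative. The size c in a coordinate
  -- k where the columns differ makes it outweigh the other monomial.
  set w : Fin d → ℝ := fun h => (if h = h₀ then -1 else 1) * (if h = k then c else 1) with hw
  have hprod : ∀ i, ∏ h, w h ^ a h i = (-1) ^ a h₀ i * c ^ a k i := by
    intro i
    simp only [hw, mul_pow, Finset.prod_mul_distrib]
    congr 1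
    · rw [Finset.prod_eq_single h₀ (fun b _ hb => by simp [hb]) (by simp)]; simp
    · rw [Finset.prod_eq_single k (fun b _ hb => by simp [hb]) (by simp)]; simp
  have h1 := ha.2 w
  rw [sopEval, huniv, hprod, hprod, hodd.neg_one_pow] at h1
  have h2 : (-1 : ℝ) ^ a h₀ j' * c ^ a k j' ≤ c ^ a k j' := by
    have := pow_pos hc0 (a k j')
    rcases neg_one_pow_eq_or ℝ (a h₀ j') with h | h <;> rw [h] <;> linarith
  linarith

theorem sopEval_eq_abs (ha : IsNonnegSop a) (w : Fin d → ℝ) :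
    sopEval a w = ∏ h, |w h| ^ a h 0 + ∏ h, |w h| ^ a h 1 := by
  simp only [sopEval, Fin.sum_univ_two, (even_of_isNonnegSop ha _ _).pow_abs]

/-- Weighted AM-GM bounds f below by ∏ |w_h|^(e_h), with e the θ-mixture of the columns. The
resulting monomial is integrable because e_h / b < s_h. -/
theorem integrableOn_sopEval_rpow (ha : IsNonnegSop a) (hW : IsCompact W) {θ B b : ℝ}
    (hs : ∀ h, 0 < s h) (hθ : θ ∈ Icc (0 : ℝ) 1)
    (hB : ∀ h, θ * a h 0 + (1 - θ) * a h 1 ≤ B * s h) (hb : 0 < b) (hBb : B < b) :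
    IntegrableOn (fun w => sopEval a w ^ (-b⁻¹) * absMonomial s w) W := by
  obtain ⟨M, _, hM⟩ := exists_subset_cube hW
  set e : Fin d → ℝ := fun h => θ * a h 0 + (1 - θ) * a h 1 with he
  have hr : ∀ h, -1 < e h * (-b⁻¹) + (s h - 1) := by
    intro h
    have h1 : e h < s h * b := by
      calc e h ≤ B * s h := hB h
        _ < b * s h := mul_lt_mul_of_pos_right hBb (hs h)
        _ = s h * b := mul_comm _ _
    have h2 : e h * b⁻¹ < s h := (mul_inv_lt_iff₀ hb).2 h1
    linarith
  refine Integrable.mono' ((integrableOn_prod_abs_rpow M hr).mono_set hM)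
    (((continuous_sopEval a).measurable.pow_const _).mul
      (measurable_absMonomial s)).aestronglyMeasurable
    ((ae_restrict_of_ae ae_forall_ne_zero).mono fun w hw => ?_)
  have hw' : ∀ h, 0 < |w h| := fun h => abs_pos.2 (hw h)
  rw [Real.norm_of_nonneg (mul_nonneg (Real.rpow_nonneg (ha.2 w) _) (absMonomial_nonneg s w))]
  set u := ∏ h, |w h| ^ a h 0 with hu
  set v := ∏ h, |w h| ^ a h 1 with hv
  have hu0 : 0 < u := Finset.prod_pos fun h _ => pow_pos (hw' h) _
  have hv0 : 0 < v := Finset.prod_pos fun h _ => pow_pos (hw' h) _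
  have hgeom : ∏ h, |w h| ^ e h ≤ sopEval a w := by
    calc ∏ h, |w h| ^ e h = u ^ θ * v ^ (1 - θ) := by
          rw [hu, hv, ← Real.finsetProd_rpow _ _ fun h _ => (pow_pos (hw' h) _).le,
            ← Real.finsetProd_rpow _ _ fun h _ => (pow_pos (hw' h) _).le, ← Finset.prod_mul_distrib]
          refine Finset.prod_congr rfl fun h _ => ?_
          rw [← Real.rpow_natCast, ← Real.rpow_natCast, ← Real.rpow_mul (hw' h).le,
            ← Real.rpow_mul (hw' h).le, ← Real.rpow_add (hw' h)]
          simp only [he]; ring_nf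
      _ ≤ θ * u + (1 - θ) * v := Real.geom_mean_le_arith_mean2_weighted hθ.1
          (sub_nonneg.2 hθ.2) hu0.le hv0.le (by ring)
      _ ≤ u + v := by
          have := hθ.1; have := hθ.2; nlinarith
      _ = sopEval a w := (sopEval_eq_abs ha w).symm
  calc sopEval a w ^ (-b⁻¹) * absMonomial s w
      ≤ (∏ h, |w h| ^ e h) ^ (-b⁻¹) * absMonomial s w :=
        mul_le_mul_of_nonneg_right (Real.rpow_le_rpow_of_nonpos
          (Finset.prod_pos fun h _ => Real.rpow_pos_of_pos (hw' h) _) hgeom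
          (neg_nonpos.2 (inv_pos.2 hb).le)) (absMonomial_nonneg s w)
    _ = ∏ h, |w h| ^ (e h * (-b⁻¹) + (s h - 1)) := by
        rw [← Real.finsetProd_rpow _ _ fun h _ => Real.rpow_nonneg (hw' h).le _, absMonomial,
          ← Finset.prod_mul_distrib]
        refine Finset.prod_congr rfl fun h _ => ?_
        rw [← Real.rpow_mul (hw' h).le, ← Real.rpow_add (hw' h)]

/-- Helly's theorem on the line. An index with x < y bounds θ from below, one with y < x bounds it
from above; `h1` makes each constraint compatible with [0, 1], `h2` makes lower and upper bounds
compatible. The witness is the largest lower bound `l h₀`. -/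
theorem exists_convexComb_le {ι : Type*} [Fintype ι] [Nonempty ι] {x y : ι → ℝ} {B : ℝ}
    (h1 : ∀ h, min (x h) (y h) ≤ B)
    (h2 : ∀ h k, x h < y h → y k < x k → y h * x k - x h * y k ≤ B * (y h + x k - x h - y k)) :
    ∃ θ ∈ Icc (0 : ℝ) 1, ∀ h, θ * x h + (1 - θ) * y h ≤ B := by
  classical
  set l : ι → ℝ := fun h => if x h < y h then max 0 ((y h - B) / (y h - x h)) else 0 with hl
  have hxB : ∀ h, x h < y h → x h ≤ B := fun h hh => by simpa [min_eq_left hh.le] using h1 h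
  have hyB : ∀ h, y h ≤ x h → y h ≤ B := fun h hh => by simpa [min_eq_right hh] using h1 h
  have hl0 : ∀ h, 0 ≤ l h := fun h => by
    simp only [hl]; split_ifs
    · exact le_max_left _ _
    · exact le_rfl
  have hl1 : ∀ h, l h ≤ 1 := fun h => by
    simp only [hl]; split_ifs with hh
    · refine max_le zero_le_one ((div_le_one (by linarith)).2 (by linarith [hxB h hh]))
    · exact zero_le_one
  obtain ⟨h₀, -, hmax⟩ := Finset.univ.exists_max_image l Finset.univ_nonempty
  refine ⟨l h₀, ⟨hl0 h₀, hl1 h₀⟩, fun h => ?_⟩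
  rcases lt_trichotomy (x h) (y h) with hh | hh | hh
  · have h3 : (y h - B) / (y h - x h) ≤ l h₀ := by
      refine le_trans ?_ (hmax h (Finset.mem_univ h))
      simp only [hl, if_pos hh]; exact le_max_right _ _
    rw [div_le_iff₀ (by linarith)] at h3
    linarith
  · rw [hh]; linarith [hyB h hh.symm.le]
  · have hy := hyB h hh.le
    suffices l h₀ * (x h - y h) ≤ B - y h by linarith
    rw [← le_div_iff₀ (by linarith)]
    have h0 : 0 ≤ (B - y h) / (x h - y h) := div_nonneg (by linarith) (by linarith)
    simp only [hl]
    split_ifs with h3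
    · refine max_le h0 ?_
      rw [div_le_div_iff₀ (by linarith) (by linarith)]
      linarith [h2 h₀ h h3 hh]
    · exact h0

theorem ciInf_fin_two (u : Fin 2 → ℝ) : ⨅ j, u j = min (u 0) (u 1) := by
  have hbdd : BddBelow (range u) := (Set.finite_range u).bddBelow
  refine le_antisymm (le_min (ciInf_le hbdd 0) (ciInf_le hbdd 1)) (le_ciInf fun j => ?_)
  fin_cases j
  · exact min_le_left _ _
  · exact min_le_right _ _

theorem muIndex_eq (hs : ∀ h, 0 < s h) (h : Fin d) :
    muIndex a s h = min ((a h 0 : ℝ) / s h) ((a h 1 : ℝ) / s h) :=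
  (min_div_div_right (hs h).le _ _).symm

theorem nuIndex_eq (hs : ∀ h, 0 < s h) (h : Fin d) :
    nuIndex a s h = max ((a h 0 : ℝ) / s h) ((a h 1 : ℝ) / s h) :=
  (max_div_div_right (hs h).le _ _).symm

theorem mem_oppositePairs_iff (hs : ∀ h, 0 < s h) {h k : Fin d} : (h, k) ∈ oppositePairs a ↔
    ((a h 0 : ℝ) / s h < (a h 1 : ℝ) / s h ∧ (a k 1 : ℝ) / s k < (a k 0 : ℝ) / s k) ∨
    ((a k 0 : ℝ) / s k < (a k 1 : ℝ) / s k ∧ (a h 1 : ℝ) / s h < (a h 0 : ℝ) / s h) := by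
  simp only [oppositePairs, mem_ofPred_eq, div_lt_div_iff_of_pos_right (hs _), Nat.cast_lt,
    mul_neg_iff, sub_pos, sub_neg, Nat.cast_lt]
  tauto

theorem muIndex_mem_simplexValues (hs : ∀ h, 0 < s h) (h : Fin d) :
    muIndex a s h ∈ simplexValues a s := by
  refine ⟨Pi.single h 1, single_mem_stdSimplex ℝ h, ?_⟩
  dsimp only
  rw [ciInf_fin_two, muIndex_eq hs]
  simp [Pi.single_apply]

/-- The value is attained on the edge joining two vertices of the simplex, at the point where the
two column sums agree. -/
theorem pairValue_mem_simplexValues {h k : Fin d} {x y x' y' : ℝ}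
    (hx : x = (a h 0 : ℝ) / s h) (hy : y = (a h 1 : ℝ) / s h)
    (hx' : x' = (a k 0 : ℝ) / s k) (hy' : y' = (a k 1 : ℝ) / s k) (h1 : x < y) (h2 : y' < x') :
    (y * x' - x * y') / (y + x' - x - y') ∈ simplexValues a s := by
  have hD : 0 < y + x' - x - y' := by linarith
  refine ⟨((x' - y') / (y + x' - x - y')) • Pi.single h 1 +
    ((y - x) / (y + x' - x - y')) • Pi.single k 1, ?_, ?_⟩
  · refine convex_stdSimplex ℝ (Fin d) (single_mem_stdSimplex ℝ h) (single_mem_stdSimplex ℝ k)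
      (div_nonneg (by linarith) hD.le) (div_nonneg (by linarith) hD.le) ?_
    rw [← add_div, div_eq_one_iff_eq hD.ne']; ring
  · dsimp only
    rw [ciInf_fin_two]
    simp only [Pi.add_apply, Pi.smul_apply, Pi.single_apply, smul_eq_mul, add_mul,
      Finset.sum_add_distrib, mul_ite, mul_one, mul_zero, ite_mul, zero_mul,
      Finset.sum_ite_eq', Finset.mem_univ, if_true, ← hx, ← hy, ← hx', ← hy']
    have e : (x' - y') / (y + x' - x - y') * y + (y - x) / (y + x' - x - y') * y' =
        (x' - y') / (y + x' - x - y') * x + (y - x) / (y + x' - x - y') * x' := by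
      field_simp; ring
    rw [e, min_self]
    field_simp; ring

theorem binomialValues_subset_simplexValues (hs : ∀ h, 0 < s h) :
    binomialValues a s ⊆ simplexValues a s := by
  rintro _ (⟨h, rfl⟩ | ⟨⟨h, k⟩, hp, rfl⟩)
  · exact muIndex_mem_simplexValues hs h
  · dsimp only
    rcases (mem_oppositePairs_iff hs).1 hp with ⟨h1, h2⟩ | ⟨h1, h2⟩
    · convert pairValue_mem_simplexValues rfl rfl rfl rfl h1 h2 using 1
      rw [nuIndex_eq hs, nuIndex_eq hs, muIndex_eq hs, muIndex_eq hs, max_eq_right h1.le,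
        max_eq_left h2.le, min_eq_left h1.le, min_eq_right h2.le]
    · convert pairValue_mem_simplexValues rfl rfl rfl rfl h1 h2 using 1
      rw [nuIndex_eq hs, nuIndex_eq hs, muIndex_eq hs, muIndex_eq hs, max_eq_right h1.le,
        max_eq_left h2.le, min_eq_left h1.le, min_eq_right h2.le]
      congr 1 <;> ring

/-- The minimax identity for binomials, together with an optimal mixed strategy `θ`. -/
theorem exists_isGreatest_binomialValues (hd : 0 < d) (hs : ∀ h, 0 < s h) (a : Fin d → Fin 2 → ℕ) :
    ∃ β, IsGreatest (simplexValues a s) β ∧ IsGreatest (binomialValues a s) β ∧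
      ∃ θ ∈ Icc (0 : ℝ) 1, ∀ h, θ * a h 0 + (1 - θ) * a h 1 ≤ β * s h := by
  have := Fin.pos_iff_nonempty.1 hd
  have hfin : (binomialValues a s).Finite :=
    (Set.finite_range _).union ((Set.toFinite _).image _)
  obtain ⟨β, hβ⟩ := hfin.isCompact.exists_isGreatest
    ⟨_, Or.inl (mem_range_self (Classical.arbitrary (Fin d)))⟩
  -- The greatest candidate β satisfies exactly the two compatibility conditions needed for θ.
  obtain ⟨θ, hθ, hle⟩ : ∃ θ ∈ Icc (0 : ℝ) 1, ∀ h,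
      θ * ((a h 0 : ℝ) / s h) + (1 - θ) * ((a h 1 : ℝ) / s h) ≤ β := by
    refine exists_convexComb_le (fun h => ?_) fun h k h1 h2 => ?_
    · rw [← muIndex_eq hs]
      exact hβ.2 (Or.inl (mem_range_self h))
    · have h3 := hβ.2 (Or.inr (mem_image_of_mem _
        ((mem_oppositePairs_iff hs).2 (Or.inl ⟨h1, h2⟩))))
      dsimp only at h3
      rw [nuIndex_eq hs, nuIndex_eq hs, muIndex_eq hs, muIndex_eq hs, max_eq_right h1.le,
        max_eq_left h2.le, min_eq_left h1.le, min_eq_right h2.le, div_le_iff₀ (by linarith)] at h3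
      exact h3
  refine ⟨β, ⟨binomialValues_subset_simplexValues hs hβ.1, ?_⟩, hβ, θ, hθ, fun h => ?_⟩
  -- Weak duality: a minimum is at most the θ-average, which is at most β.
  · rintro _ ⟨α, hα, rfl⟩
    dsimp only
    rw [ciInf_fin_two]
    set u := ∑ h, α h * ((a h 0 : ℝ) / s h) with hu
    set v := ∑ h, α h * ((a h 1 : ℝ) / s h) with hv
    have h0 := hθ.1
    have h1 := sub_nonneg.2 hθ.2
    calc min u v = θ * min u v + (1 - θ) * min u v := by ring
      _ ≤ θ * u + (1 - θ) * v := by gcongr <;> simp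
      _ = ∑ h, α h * (θ * ((a h 0 : ℝ) / s h) + (1 - θ) * ((a h 1 : ℝ) / s h)) := by
          rw [hu, hv, Finset.mul_sum, Finset.mul_sum, ← Finset.sum_add_distrib]
          exact Finset.sum_congr rfl fun h _ => by ring
      _ ≤ ∑ h, α h * β := Finset.sum_le_sum fun h _ => mul_le_mul_of_nonneg_left (hle h) (hα.1 h)
      _ = β := by rw [← Finset.sum_mul, hα.2, one_mul]
  · have h1 := mul_le_mul_of_nonneg_right (hle h) (hs h).le
    have h2 := (hs h).ne'
    calc θ * a h 0 + (1 - θ) * a h 1 =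
          (θ * ((a h 0 : ℝ) / s h) + (1 - θ) * ((a h 1 : ℝ) / s h)) * s h := by field_simp
      _ ≤ _ := h1

theorem one_div_le_ofReal_of_isLargestPole (ha : IsNonnegSop a) (hW : IsCompact W)
    (hs : ∀ h, 0 < s h) {θ β : ℝ} (hθ : θ ∈ Icc (0 : ℝ) 1)
    (hβ : ∀ h, θ * a h 0 + (1 - θ) * a h 1 ≤ β * s h) {lam : ℝ≥0∞}
    (hlam : ∀ b : ℝ, 0 < b →
      IntegrableOn (fun w => sopEval a w ^ (-b⁻¹) * absMonomial s w) W →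
        1 / lam ≤ ENNReal.ofReal b) : 1 / lam ≤ ENNReal.ofReal β := by
  refine le_of_forall_gt fun c hc => ?_
  obtain ⟨b, hb1, hb2⟩ := exists_between hc
  have hbt : b ≠ ∞ := hb2.ne_top
  have hbpos : 0 < b.toReal := ENNReal.toReal_pos (pos_of_gt hb1).ne' hbt
  rw [← ENNReal.ofReal_toReal hbt] at hb1 hb2
  exact (hlam _ hbpos (integrableOn_sopEval_rpow ha hW hs hθ hβ hbpos
    ((ENNReal.ofReal_lt_ofReal_iff hbpos).1 hb1))).trans_lt hb2

end Binomial

/-! ### Meromorphic extension from large real arguments -/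

section Extension

/-- `J`, given for large real arguments, extends to a meromorphic function on `U`. -/
def ExtendsTo (U : Set ℂ) (J : ℝ → ℝ) : Prop :=
  ∃ F : ℂ → ℂ, MeromorphicOn F U ∧ ∀ᶠ x : ℝ in atTop, F x = (J x : ℂ)

namespace ExtendsTo

variable {U : Set ℂ} {J K : ℝ → ℝ}

theorem congr (h : ExtendsTo U J) (hJK : J =ᶠ[atTop] K) : ExtendsTo U K := by
  obtain ⟨F, hF, hFJ⟩ := h
  exact ⟨F, hF, by filter_upwards [hFJ, hJK] with x h1 h2; rw [h1, h2]⟩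

theorem mono {V : Set ℂ} (h : ExtendsTo U J) (hV : V ⊆ U) : ExtendsTo V J := by
  obtain ⟨F, hF, hFJ⟩ := h
  exact ⟨F, hF.mono_set hV, hFJ⟩

theorem of_analytic {F : ℂ → ℂ} (hF : AnalyticOnNhd ℂ F U) (h : ∀ x : ℝ, F x = (J x : ℂ)) :
    ExtendsTo U J :=
  ⟨F, hF.meromorphicOn, Eventually.of_forall h⟩

theorem const (c : ℝ) : ExtendsTo U fun _ => c :=
  of_analytic (F := fun _ => (c : ℂ)) (fun _ _ => analyticAt_const) fun _ => rfl

theorem id : ExtendsTo U fun x => x :=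
  of_analytic (F := fun z => z) (fun _ _ => analyticAt_id) fun _ => rfl

theorem const_rpow {c : ℝ} (hc : 0 < c) : ExtendsTo U fun x => c ^ x := by
  refine of_analytic (F := fun z => (c : ℂ) ^ z) (fun z _ => ?_) fun x => ?_
  · exact analyticAt_const.cpow analyticAt_id (by simp [Complex.slitPlane, hc])
  · rw [Complex.ofReal_cpow hc.le]

theorem add (h : ExtendsTo U J) (h' : ExtendsTo U K) : ExtendsTo U fun x => J x + K x := by
  obtain ⟨F, hF, hFJ⟩ := h
  obtain ⟨G, hG, hGK⟩ := h'
  exact ⟨fun z => F z + G z, hF.add hG, by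
    filter_upwards [hFJ, hGK] with x h1 h2; rw [h1, h2, Complex.ofReal_add]⟩

theorem sub (h : ExtendsTo U J) (h' : ExtendsTo U K) : ExtendsTo U fun x => J x - K x := by
  obtain ⟨F, hF, hFJ⟩ := h
  obtain ⟨G, hG, hGK⟩ := h'
  exact ⟨fun z => F z - G z, hF.sub hG, by
    filter_upwards [hFJ, hGK] with x h1 h2; rw [h1, h2, Complex.ofReal_sub]⟩

theorem mul (h : ExtendsTo U J) (h' : ExtendsTo U K) : ExtendsTo U fun x => J x * K x := by
  obtain ⟨F, hF, hFJ⟩ := h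
  obtain ⟨G, hG, hGK⟩ := h'
  exact ⟨fun z => F z * G z, hF.mul hG, by
    filter_upwards [hFJ, hGK] with x h1 h2; rw [h1, h2, Complex.ofReal_mul]⟩

theorem div (h : ExtendsTo U J) (h' : ExtendsTo U K) : ExtendsTo U fun x => J x / K x := by
  obtain ⟨F, hF, hFJ⟩ := h
  obtain ⟨G, hG, hGK⟩ := h'
  exact ⟨fun z => F z / G z, hF.div hG, by
    filter_upwards [hFJ, hGK] with x h1 h2; rw [h1, h2, Complex.ofReal_div]⟩

theorem comp_sub_one (h : ExtendsTo U J) :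
    ExtendsTo {z | z - 1 ∈ U} fun x => J (x - 1) := by
  obtain ⟨F, hF, hFJ⟩ := h
  refine ⟨fun z => F (z - 1), fun z hz => ?_, ?_⟩
  · exact MeromorphicAt.comp_analyticAt (f := F) (g := fun z => z - 1) (hF _ hz)
      (analyticAt_id.sub analyticAt_const)
  · have := (tendsto_atTop_add_const_right atTop (-1 : ℝ) tendsto_id).eventually hFJ
    filter_upwards [this] with x hx
    simpa [sub_eq_add_neg] using hx

end ExtendsTo

/-- Agreement on a real ray accumulates at a point of the ray, which is what the identity theorem
needs. -/
theorem frequently_nhdsNE_of_eventually_atTop {F G : ℂ → ℂ}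
    (h : ∀ᶠ x : ℝ in atTop, F x = G x) {P : ℝ → Prop} (hP : ∀ᶠ x : ℝ in atTop, P x) :
    ∃ x : ℝ, P x ∧ ∃ᶠ z in 𝓝[≠] (x : ℂ), F z = G z := by
  obtain ⟨R, hR⟩ := eventually_atTop.1 (h.and hP)
  refine ⟨R + 1, (hR _ (by linarith)).2, ?_⟩
  have hR1 : ∀ᶠ y : ℝ in 𝓝[≠] (R + 1), F y = G y := by
    refine eventually_nhdsWithin_of_eventually_nhds ?_
    filter_upwards [lt_mem_nhds (show R < R + 1 by linarith)] with y hy using (hR y hy.le).1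
  have hmap : Tendsto (fun y : ℝ => (y : ℂ)) (𝓝[≠] (R + 1)) (𝓝[≠] ((R + 1 : ℝ) : ℂ)) := by
    refine tendsto_nhdsWithin_of_tendsto_nhds_of_eventually_within _
      (Complex.continuous_ofReal.continuousAt.mono_left nhdsWithin_le_nhds) ?_
    filter_upwards [self_mem_nhdsWithin] with y hy
    exact fun h => hy (Complex.ofReal_injective h)
  exact hmap.frequently hR1.frequently

/-- Meromorphic extensions to the members of an exhaustion can be glued. -/
theorem ExtendsTo.iUnion {U : ℕ → Set ℂ} {J : ℝ → ℝ} (hmono : Monotone U) (hopen : ∀ N, IsOpen (U N))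
    (hconn : ∀ N, IsPreconnected (U N)) (hcover : ∀ z, ∃ N, z ∈ U N)
    (hreal : ∀ᶠ x : ℝ in atTop, (x : ℂ) ∈ U 0) {F₀ : ℂ → ℂ} (hF₀ : AnalyticOnNhd ℂ F₀ (U 0))
    (hF₀J : ∀ᶠ x : ℝ in atTop, F₀ x = (J x : ℂ)) (h : ∀ N, ExtendsTo (U N) J) :
    ExtendsTo univ J := by
  classical
  choose F hF hFJ using h
  have hident : ∀ {V : Set ℂ} {G H : ℂ → ℂ}, IsPreconnected V → U 0 ⊆ V → MeromorphicOn G V →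
      MeromorphicOn H V → (∀ᶠ x : ℝ in atTop, G x = (J x : ℂ)) →
      (∀ᶠ x : ℝ in atTop, H x = (J x : ℂ)) → ∀ y ∈ V, G =ᶠ[𝓝[≠] y] H := by
    intro V G H hV hUV hG hH hGJ hHJ y hy
    obtain ⟨x, hx, hfreq⟩ := frequently_nhdsNE_of_eventually_atTop
      (F := G) (G := H) (by filter_upwards [hGJ, hHJ] with x h1 h2; rw [h1, h2]) hreal
    exact hG.eventuallyEq_of_frequently_eq hH hV (hUV hx) hfreq hy
  -- The normalised value depends only on the punctured germ, so the choice of the least N is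
  -- immaterial. In a punctured neighbourhood of a point of `U N` it equals `F N`, which is analytic
  -- there.
  refine ⟨fun z => toMeromorphicNFAt (F (Nat.find (hcover z))) z z, fun y _ => ?_, ?_⟩
  · obtain ⟨N, hN⟩ := hcover y
    refine (hF N y hN).congr ?_
    filter_upwards [(hF N y hN).eventually_analyticAt,
      eventually_nhdsWithin_of_eventually_nhds ((hopen N).mem_nhds hN)] with z hz hzN
    have hle : Nat.find (hcover z) ≤ N := Nat.find_min' _ hzN
    have heq : F (Nat.find (hcover z)) =ᶠ[𝓝[≠] z] F N :=
      hident (hconn _) (hmono (Nat.zero_le _)) (hF _) ((hF N).mono_set (hmono hle)) (hFJ _) (hFJ _) z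
        (Nat.find_spec (hcover z))
    rw [(toMeromorphicNFAt_eventuallyEq_nhds_congr heq).eq_of_nhds,
      toMeromorphicNFAt_eq_self.2 hz.meromorphicNFAt]
  · filter_upwards [hreal, hF₀J] with x hx hxJ
    have h0 : Nat.find (hcover (x : ℂ)) = 0 := (Nat.find_eq_zero _).2 hx
    have heq : F (Nat.find (hcover (x : ℂ))) =ᶠ[𝓝[≠] (x : ℂ)] F₀ := by
      rw [h0]
      exact hident (hconn 0) subset_rfl (hF 0) hF₀.meromorphicOn (hFJ 0) hF₀J _ hx
    rw [(toMeromorphicNFAt_eventuallyEq_nhds_congr heq).eq_of_nhds,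
      toMeromorphicNFAt_eq_self.2 (hF₀ _ hx).meromorphicNFAt, hxJ]

end Extension

/-! ### Binomial integrals and integration by parts in one variable -/

section BinomialIntegral

variable {d : ℕ} {M c₁ c₂ : ℝ} {a b : Fin d → ℕ} {s : Fin d → ℝ}

/-- The binomial `c₁ |w|^a + c₂ |w|^b`. -/
def absBinomial (c₁ c₂ : ℝ) (a b : Fin d → ℕ) (w : Fin d → ℝ) : ℝ :=
  c₁ * ∏ h, |w h| ^ a h + c₂ * ∏ h, |w h| ^ b h

/-- The integral of `(c₁ |w|^a + c₂ |w|^b)^x |w|^{s-1}` over the cube `[-M, M]^d`. -/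
noncomputable def binomialIntegral (M c₁ c₂ : ℝ) (a b : Fin d → ℕ) (s : Fin d → ℝ) (x : ℝ) : ℝ :=
  ∫ w in cube d M, absBinomial c₁ c₂ a b w ^ x * absMonomial s w

/-- The contribution of the first monomial to `binomialIntegral`. -/
noncomputable def binomialIntegralPart (M c₁ c₂ : ℝ) (a b : Fin d → ℕ) (s : Fin d → ℝ) (x : ℝ) : ℝ :=
  ∫ w in cube d M,
    absBinomial c₁ c₂ a b w ^ (x - 1) * (c₁ * ∏ h, |w h| ^ a h) * absMonomial s w

theorem absBinomial_comm (c₁ c₂ : ℝ) (a b : Fin d → ℕ) :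
    absBinomial c₁ c₂ a b = absBinomial c₂ c₁ b a :=
  funext fun _ => add_comm _ _

theorem binomialIntegral_comm (M c₁ c₂ : ℝ) (a b : Fin d → ℕ) (s : Fin d → ℝ) :
    binomialIntegral M c₁ c₂ a b s = binomialIntegral M c₂ c₁ b a s := by
  unfold binomialIntegral
  rw [absBinomial_comm]

theorem continuous_absBinomial (c₁ c₂ : ℝ) (a b : Fin d → ℕ) :
    Continuous (absBinomial c₁ c₂ a b) := by
  unfold absBinomial
  fun_prop

theorem absBinomial_nonneg (h₁ : 0 < c₁) (h₂ : 0 < c₂) (w : Fin d → ℝ) :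
    0 ≤ absBinomial c₁ c₂ a b w := by
  unfold absBinomial
  positivity

theorem ae_absBinomial_pos (h₁ : 0 < c₁) (h₂ : 0 < c₂) {W : Set (Fin d → ℝ)} :
    ∀ᵐ w ∂(volume.restrict W), 0 < absBinomial c₁ c₂ a b w := by
  filter_upwards [ae_restrict_of_ae ae_forall_ne_zero] with w hw
  have : ∀ h, 0 < |w h| := fun h => abs_pos.2 (hw h)
  have h3 : 0 < ∏ h, |w h| ^ a h := Finset.prod_pos fun h _ => pow_pos (this h) _
  have h4 : 0 < ∏ h, |w h| ^ b h := Finset.prod_pos fun h _ => pow_pos (this h) _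
  unfold absBinomial
  positivity

theorem integrableOn_continuous_mul_absMonomial (hs : ∀ h, 0 < s h) {φ : (Fin d → ℝ) → ℝ}
    (hφ : Continuous φ) : IntegrableOn (fun w => φ w * absMonomial s w) (cube d M) :=
  (integrableOn_absMonomial hs (isCompact_cube d M)).continuousOn_mul hφ.continuousOn
    (isCompact_cube d M)

theorem continuous_absBinomial_rpow {y : ℝ} (hy : 0 ≤ y) :
    Continuous fun w => absBinomial c₁ c₂ a b w ^ y :=
  (continuous_absBinomial c₁ c₂ a b).rpow_const fun _ => Or.inr hy

theorem integrableOn_binomialIntegralPart (hs : ∀ h, 0 < s h) {x : ℝ} (hx : 1 ≤ x) (c : ℝ)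
    (e : Fin d → ℕ) : IntegrableOn (fun w =>
      absBinomial c₁ c₂ a b w ^ (x - 1) * (c * ∏ h, |w h| ^ e h) * absMonomial s w) (cube d M) :=
  integrableOn_continuous_mul_absMonomial hs
    ((continuous_absBinomial_rpow (sub_nonneg.2 hx)).mul (by fun_prop))

theorem binomialIntegral_eq_add (h₁ : 0 < c₁) (h₂ : 0 < c₂) (hs : ∀ h, 0 < s h) {x : ℝ}
    (hx : 1 ≤ x) : binomialIntegral M c₁ c₂ a b s x =
      binomialIntegralPart M c₁ c₂ a b s x + binomialIntegralPart M c₂ c₁ b a s x := by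
  unfold binomialIntegral binomialIntegralPart
  rw [absBinomial_comm c₂ c₁, ← integral_add (integrableOn_binomialIntegralPart hs hx _ _)
    (integrableOn_binomialIntegralPart hs hx _ _)]
  refine integral_congr_ae ((ae_absBinomial_pos (a := a) (b := b) h₁ h₂).mono fun w hw => ?_)
  dsimp only
  rw [← add_mul, ← mul_add]
  change _ = absBinomial c₁ c₂ a b w ^ (x - 1) * absBinomial c₁ c₂ a b w * _
  rw [Real.rpow_sub_one hw.ne', div_mul_cancel₀ _ hw.ne']

theorem setIntegral_Icc_comp_abs {φ : ℝ → ℝ} (hM : 0 ≤ M)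
    (hφ : IntervalIntegrable φ volume 0 M) :
    ∫ t in Icc (-M) M, φ |t| = 2 * ∫ t in (0 : ℝ)..M, φ t := by
  have h1 : IntervalIntegrable (fun t => φ |t|) volume 0 M :=
    hφ.congr_uIoo fun t ht => by
      rw [uIoo_of_le hM] at ht
      simp [abs_of_pos ht.1]
  have h2 : IntervalIntegrable (fun t => φ |t|) volume (-M) 0 := by
    rw [IntervalIntegrable.iff_comp_neg]
    simpa using h1.symm
  have h3 : ∫ t in (0 : ℝ)..M, φ |t| = ∫ t in (0 : ℝ)..M, φ t :=
    intervalIntegral.integral_congr fun t ht => by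
      rw [uIcc_of_le hM] at ht
      simp [abs_of_nonneg ht.1]
  have h4 : ∫ t in (-M)..0, φ |t| = ∫ t in (0 : ℝ)..M, φ |t| := by
    have := intervalIntegral.integral_comp_neg (a := 0) (b := M) fun t => φ |t|
    simpa using this.symm
  rw [integral_Icc_eq_integral_Ioc, ← intervalIntegral.integral_of_le (by linarith),
    ← intervalIntegral.integral_add_adjacent_intervals h2 h1, h4, h3]
  ring

/-- Integration by parts in one variable. -/
theorem setIntegral_Icc_binomial (hM : 0 < M) {P Q σ x : ℝ} (hP : 0 ≤ P) (hQ : 0 ≤ Q) (hσ : 0 < σ)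
    (hx : 1 ≤ x) (α β : ℕ) :
    ∫ t in Icc (-M) M, (P * |t| ^ α + Q * |t| ^ β) ^ (x - 1) *
      ((x * α + σ) * (P * |t| ^ α) + (x * β + σ) * (Q * |t| ^ β)) * |t| ^ (σ - 1) =
    2 * (M ^ σ * (P * M ^ α + Q * M ^ β) ^ x) := by
  set φ : ℝ → ℝ := fun t => (P * t ^ α + Q * t ^ β) ^ (x - 1) *
      ((x * α + σ) * (P * t ^ α) + (x * β + σ) * (Q * t ^ β)) * t ^ (σ - 1) with hφ
  have hcont : Continuous fun t : ℝ => (P * t ^ α + Q * t ^ β) ^ (x - 1) *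
      ((x * α + σ) * (P * t ^ α) + (x * β + σ) * (Q * t ^ β)) :=
    Continuous.mul (Continuous.rpow_const (by fun_prop) fun _ => Or.inr (sub_nonneg.2 hx))
      (by fun_prop)
  have hint : IntervalIntegrable φ volume 0 M :=
    (intervalIntegral.intervalIntegrable_rpow' (by linarith)).continuousOn_mul hcont.continuousOn
  rw [setIntegral_Icc_comp_abs (φ := φ) hM.le hint]
  congr 1
  -- The integrand is the derivative of this function, which vanishes at 0 because σ > 0.
  have hG : ContinuousOn (fun t : ℝ => t ^ σ * (P * t ^ α + Q * t ^ β) ^ x) (Icc 0 M) := by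
    refine Continuous.continuousOn (Continuous.mul ?_ ?_)
    · exact Continuous.rpow_const continuous_id fun _ => Or.inr hσ.le
    · exact Continuous.rpow_const (by fun_prop) fun _ => Or.inr (by linarith)
  rw [intervalIntegral.integral_eq_sub_of_hasDerivAt_of_le hM.le hG (fun t ht => ?_) hint,
    Real.zero_rpow hσ.ne']
  · ring
  have ht0 : 0 < t := ht.1
  set u := P * t ^ α + Q * t ^ β with hu
  have hu0 : 0 ≤ u := by positivity
  have hpow : ∀ k : ℕ, HasDerivAt (fun t : ℝ => t ^ k) (k * t ^ k / t) t := fun k => by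
    have := hasDerivAt_pow k t
    refine this.congr_deriv ?_
    rcases k with _ | k
    · simp
    · rw [pow_succ, ← mul_assoc, mul_div_cancel_right₀ _ ht0.ne', Nat.add_sub_cancel]
  have h1 : HasDerivAt (fun t : ℝ => P * t ^ α + Q * t ^ β)
      (P * (α * t ^ α / t) + Q * (β * t ^ β / t)) t :=
    ((hpow α).const_mul P).add ((hpow β).const_mul Q)
  have h2 := h1.rpow_const (p := x) (Or.inr hx)
  have h3 : HasDerivAt (fun t : ℝ => t ^ σ) (σ * t ^ (σ - 1)) t :=
    Real.hasDerivAt_rpow_const (Or.inl ht0.ne')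
  refine (h3.mul h2).congr_deriv ?_
  have e1 : u ^ x = u ^ (x - 1) * u := by
    conv_lhs => rw [show x = (x - 1) + 1 by ring]
    rw [Real.rpow_add_of_nonneg hu0 (by linarith) zero_le_one, Real.rpow_one]
  have e2 : t ^ σ = t ^ (σ - 1) * t := by
    rw [Real.rpow_sub_one ht0.ne', div_mul_cancel₀ _ ht0.ne']
  simp only [hφ, ← hu]
  rw [e1, e2]
  field_simp
  rw [hu]
  ring

end BinomialIntegral

/-! ### Continuation of binomial integrals by induction on the dimension -/

section Recursion

variable {d : ℕ} {M c₁ c₂ : ℝ}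

theorem absMonomial_insertNth (i : Fin (d + 1)) (s : Fin (d + 1) → ℝ) (t : ℝ) (w : Fin d → ℝ) :
    absMonomial s (i.insertNth t w) =
      |t| ^ (s i - 1) * absMonomial (fun j => s (i.succAbove j)) w := by
  simp [absMonomial, Fin.prod_univ_succAbove _ i]

theorem prod_abs_pow_insertNth (i : Fin (d + 1)) (a : Fin (d + 1) → ℕ) (t : ℝ) (w : Fin d → ℝ) :
    ∏ h, |(i.insertNth t w : Fin (d + 1) → ℝ) h| ^ a h =
      |t| ^ a i * ∏ j, |w j| ^ a (i.succAbove j) := by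
  simp [Fin.prod_univ_succAbove _ i]

/-- Integration by parts in the direction of the `i`-th Euler operator. -/
theorem binomialIntegralPart_relation (hM : 0 < M) (h₁ : 0 < c₁) (h₂ : 0 < c₂)
    (i : Fin (d + 1)) (a b : Fin (d + 1) → ℕ) {s : Fin (d + 1) → ℝ} (hs : ∀ h, 0 < s h) {x : ℝ}
    (hx : 1 ≤ x) :
    (x * a i + s i) * binomialIntegralPart M c₁ c₂ a b s x +
      (x * b i + s i) * binomialIntegralPart M c₂ c₁ b a s x =
    2 * M ^ s i * binomialIntegral M (c₁ * M ^ a i) (c₂ * M ^ b i) (fun j => a (i.succAbove j))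
      (fun j => b (i.succAbove j)) (fun j => s (i.succAbove j)) x := by
  set Φ : (Fin (d + 1) → ℝ) → ℝ := fun w =>
    (x * a i + s i) * (absBinomial c₁ c₂ a b w ^ (x - 1) * (c₁ * ∏ h, |w h| ^ a h) * absMonomial s w) +
    (x * b i + s i) * (absBinomial c₁ c₂ a b w ^ (x - 1) * (c₂ * ∏ h, |w h| ^ b h) * absMonomial s w)
    with hΦ
  have hi₁ := (integrableOn_binomialIntegralPart (M := M) (c₁ := c₁) (c₂ := c₂) (a := a) (b := b)
    hs hx c₁ a).const_mul (x * a i + s i)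
  have hi₂ := (integrableOn_binomialIntegralPart (M := M) (c₁ := c₁) (c₂ := c₂) (a := a) (b := b)
    hs hx c₂ b).const_mul (x * b i + s i)
  have hΦint : IntegrableOn Φ (cube (d + 1) M) := hi₁.add hi₂
  have hmp := measurePreserving_insertNth_cube M i
  have hemb := measurableEmbedding_insertNth i
  calc (x * a i + s i) * binomialIntegralPart M c₁ c₂ a b s x +
        (x * b i + s i) * binomialIntegralPart M c₂ c₁ b a s x = ∫ w in cube (d + 1) M, Φ w := by
        unfold binomialIntegralPart
        rw [absBinomial_comm c₂ c₁, ← integral_const_mul, ← integral_const_mul,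
          ← integral_add hi₁ hi₂]
    _ = ∫ w in cube d M, ∫ t in Icc (-M) M, Φ (i.insertNth t w) := by
        rw [← hmp.integral_comp hemb, integral_prod_symm]
        exact (hmp.integrable_comp_emb hemb).2 hΦint
    _ = ∫ w in cube d M, 2 * M ^ s i * (absBinomial (c₁ * M ^ a i) (c₂ * M ^ b i)
          (fun j => a (i.succAbove j)) (fun j => b (i.succAbove j)) w ^ x *
          absMonomial (fun j => s (i.succAbove j)) w) := by
        congr 1
        ext w
        set P := c₁ * ∏ j, |w j| ^ a (i.succAbove j) with hP
        set Q := c₂ * ∏ j, |w j| ^ b (i.succAbove j) with hQ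
        have hP0 : 0 ≤ P := by positivity
        have hQ0 : 0 ≤ Q := by positivity
        have h3 := setIntegral_Icc_binomial hM hP0 hQ0 (hs i) hx (a i) (b i)
        have h4 : ∀ t : ℝ, Φ (i.insertNth t w) =
            (P * |t| ^ a i + Q * |t| ^ b i) ^ (x - 1) *
            ((x * a i + s i) * (P * |t| ^ a i) + (x * b i + s i) * (Q * |t| ^ b i)) *
            |t| ^ (s i - 1) * absMonomial (fun j => s (i.succAbove j)) w := by
          intro t
          simp only [hΦ, absBinomial, absMonomial_insertNth, prod_abs_pow_insertNth]
          rw [show c₁ * (|t| ^ a i * ∏ j, |w j| ^ a (i.succAbove j)) = P * |t| ^ a i by rw [hP]; ring,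
            show c₂ * (|t| ^ b i * ∏ j, |w j| ^ b (i.succAbove j)) = Q * |t| ^ b i by rw [hQ]; ring]
          ring
        simp only [h4]
        rw [integral_mul_const, h3, absBinomial,
          show c₁ * M ^ a i * ∏ j, |w j| ^ a (i.succAbove j) = P * M ^ a i by rw [hP]; ring,
          show c₂ * M ^ b i * ∏ j, |w j| ^ b (i.succAbove j) = Q * M ^ b i by rw [hQ]; ring]
        ring
    _ = _ := by rw [integral_const_mul, binomialIntegral]

/-- Absorbing the monomial into the weight changes s to s + b and x to x - 1: the step of the
recursion in the degenerate case. -/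
theorem binomialIntegralPart_eq_binomialIntegral (M c₁ c₂ : ℝ) (a b : Fin d → ℕ) (s : Fin d → ℝ)
    (x : ℝ) : binomialIntegralPart M c₂ c₁ b a s x =
      c₂ * binomialIntegral M c₁ c₂ a b (fun h => s h + b h) (x - 1) := by
  unfold binomialIntegralPart binomialIntegral
  rw [← integral_const_mul, absBinomial_comm c₂ c₁]
  refine integral_congr_ae ((ae_restrict_of_ae ae_forall_ne_zero).mono fun w hw => ?_)
  have h1 : absMonomial (fun h => s h + b h) w = (∏ h, |w h| ^ b h) * absMonomial s w := by
    unfold absMonomial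
    rw [← Finset.prod_mul_distrib]
    refine Finset.prod_congr rfl fun h _ => ?_
    rw [← Real.rpow_natCast, ← Real.rpow_add (abs_pos.2 (hw h))]
    congr 1
    ring
  dsimp only
  rw [h1]
  ring

/-- The extension property for all binomial integrals in `d` variables. -/
def BinomialIntegralsExtend (M : ℝ) (d : ℕ) : Prop :=
  ∀ (c₁ c₂ : ℝ) (a b : Fin d → ℕ) (s : Fin d → ℝ), 0 < c₁ → 0 < c₂ → (∀ h, 0 < s h) →
    ExtendsTo univ (binomialIntegral M c₁ c₂ a b s)

/-- The boundary term of `binomialIntegralPart_relation`. -/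
noncomputable def binomialBoundary (M c₁ c₂ : ℝ) (i : Fin (d + 1)) (a b : Fin (d + 1) → ℕ)
    (s : Fin (d + 1) → ℝ) (x : ℝ) : ℝ :=
  2 * M ^ s i * binomialIntegral M (c₁ * M ^ a i) (c₂ * M ^ b i) (fun j => a (i.succAbove j))
    (fun j => b (i.succAbove j)) (fun j => s (i.succAbove j)) x

theorem BinomialIntegralsExtend.boundary (hext : BinomialIntegralsExtend M d) (hM : 0 < M)
    (h₁ : 0 < c₁) (h₂ : 0 < c₂) (i : Fin (d + 1)) (a b : Fin (d + 1) → ℕ) {s : Fin (d + 1) → ℝ}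
    (hs : ∀ h, 0 < s h) (U : Set ℂ) : ExtendsTo U (binomialBoundary M c₁ c₂ i a b s) :=
  (ExtendsTo.const _).mul ((hext _ _ _ _ _ (by positivity) (by positivity) fun _ => hs _).mono
    (subset_univ U))

theorem ExtendsTo.affine (U : Set ℂ) (p q : ℝ) : ExtendsTo U fun x => x * p + q :=
  (ExtendsTo.id.mul (ExtendsTo.const p)).add (ExtendsTo.const q)

theorem affine_pos {a : ℕ} {q x : ℝ} (hq : 0 < q) (hx : 1 ≤ x) : 0 < x * a + q := by positivity

theorem binomialIntegralsExtend_zero (M : ℝ) : BinomialIntegralsExtend M 0 := by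
  intro c₁ c₂ a b s h₁ h₂ _
  refine ((ExtendsTo.const_rpow (add_pos h₁ h₂)).mul
    (ExtendsTo.const ((volume.restrict (cube 0 M)).real univ))).congr (Eventually.of_forall fun x => ?_)
  simp [binomialIntegral, absBinomial, absMonomial, mul_comm]

/-- Both halves carry the same coefficient x a_i + s_i, so one relation gives their sum. -/
theorem binomialIntegral_extends_of_eq (hext : BinomialIntegralsExtend M d) (hM : 0 < M)
    (h₁ : 0 < c₁) (h₂ : 0 < c₂) {a b : Fin (d + 1) → ℕ} {s : Fin (d + 1) → ℝ}
    (hs : ∀ h, 0 < s h) {i : Fin (d + 1)} (hi : a i = b i) :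
    ExtendsTo univ (binomialIntegral M c₁ c₂ a b s) := by
  refine ((hext.boundary hM h₁ h₂ i a b hs univ).div (ExtendsTo.affine univ (a i) (s i))).congr ?_
  filter_upwards [eventually_ge_atTop 1] with x hx
  have h3 := binomialIntegralPart_relation hM h₁ h₂ i a b hs hx
  rw [← hi, ← mul_add, ← binomialIntegral_eq_add h₁ h₂ hs hx] at h3
  rw [div_eq_iff (affine_pos (hs i) hx).ne', binomialBoundary, ← hi, ← h3]
  ring

theorem eventually_quadratic_ne_zero {u v : ℝ} (h : u ≠ 0 ∨ v ≠ 0) :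
    ∀ᶠ x : ℝ in atTop, x * (x * u + v) ≠ 0 := by
  filter_upwards [eventually_gt_atTop 0, eventually_ne_atTop (-v / u)] with x hx hxu
  refine mul_ne_zero hx.ne' fun h0 => ?_
  rcases eq_or_ne u 0 with hu | hu
  · rw [hu, mul_zero, zero_add] at h0
    exact h.elim (fun h => h hu) (fun h => h h0)
  · exact hxu ((eq_div_iff hu).2 (by linarith))

/-- Cramer's rule for the relations at i and k. Their determinant is x (x u + v), where u and v are
the two quantities in `hik`. -/
theorem binomialIntegral_extends_of_det (hext : BinomialIntegralsExtend M d) (hM : 0 < M)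
    (h₁ : 0 < c₁) (h₂ : 0 < c₂) {a b : Fin (d + 1) → ℕ} {s : Fin (d + 1) → ℝ}
    (hs : ∀ h, 0 < s h) {i k : Fin (d + 1)}
    (hik : (a i * b k - b i * a k : ℝ) ≠ 0 ∨ s k * (a i - b i) - s i * (a k - b k) ≠ 0) :
    ExtendsTo univ (binomialIntegral M c₁ c₂ a b s) := by
  have hE := hext.boundary hM h₁ h₂ i a b hs univ
  have hE' := hext.boundary hM h₁ h₂ k a b hs univ
  have hp := fun j => ExtendsTo.affine univ (a j) (s j)
  have hq := fun j => ExtendsTo.affine univ (b j) (s j)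
  refine (((hE.mul ((hq k).sub (hp k))).add (hE'.mul ((hp i).sub (hq i)))).div
    (((hp i).mul (hq k)).sub ((hq i).mul (hp k)))).congr ?_
  filter_upwards [eventually_ge_atTop 1, eventually_quadratic_ne_zero hik] with x hx hdet
  have h3 := binomialIntegralPart_relation hM h₁ h₂ i a b hs hx
  have h4 := binomialIntegralPart_relation hM h₁ h₂ k a b hs hx
  have hdet' : (x * a i + s i) * (x * b k + s k) - (x * b i + s i) * (x * a k + s k) ≠ 0 := by
    convert hdet using 1; ring
  rw [div_eq_iff hdet', binomialIntegral_eq_add h₁ h₂ hs hx]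
  unfold binomialBoundary
  rw [← h3, ← h4]
  ring

/-- The domain reached after `N` steps of the recursion in the degenerate case. -/
def stepDomain (p q r : ℝ) (N : ℕ) : Set ℂ := {z | 0 < p * z.re + N * (q - p) + r}

/-- Since a ≤ b, the binomial is comparable to |w|^a on the cube. The two summands of the constant
serve t ≥ 0 and t ≤ 0. -/
theorem absBinomial_rpow_le (h₁ : 0 < c₁) (h₂ : 0 < c₂) {a b : Fin d → ℕ}
    (hab : ∀ h, a h ≤ b h) {w : Fin d → ℝ} (hw : w ∈ cube d M) (hw0 : ∀ h, w h ≠ 0) (t : ℝ) :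
    absBinomial c₁ c₂ a b w ^ t ≤
      ((c₁ + c₂ * ∏ h, M ^ (b h - a h)) ^ t + c₁ ^ t) * ∏ h, |w h| ^ (a h * t) := by
  have hpos : ∀ h, 0 < |w h| := fun h => abs_pos.2 (hw0 h)
  have hwM : ∀ h, |w h| ≤ M := fun h => abs_le.2 ⟨hw.1 h, hw.2 h⟩
  have hM : ∀ h : Fin d, 0 < M := fun h => (hpos h).trans_le (hwM h)
  set u := ∏ h, |w h| ^ a h with hu
  set C := c₁ + c₂ * ∏ h, M ^ (b h - a h) with hC
  have hC0 : 0 < C := by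
    have : 0 < ∏ h : Fin d, M ^ (b h - a h) := Finset.prod_pos fun h _ => pow_pos (hM h) _
    positivity
  have hu0 : 0 < u := Finset.prod_pos fun h _ => pow_pos (hpos h) _
  have hv : ∏ h, |w h| ^ b h ≤ u * ∏ h, M ^ (b h - a h) := by
    rw [hu, ← Finset.prod_mul_distrib]
    refine Finset.prod_le_prod (fun h _ => (pow_pos (hpos h) _).le) fun h _ => ?_
    conv_lhs => rw [← Nat.add_sub_cancel' (hab h), pow_add]
    exact mul_le_mul_of_nonneg_left (pow_le_pow_left₀ (hpos h).le (hwM h) _) (pow_pos (hpos h) _).le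
  have hlow : c₁ * u ≤ absBinomial c₁ c₂ a b w := le_add_of_nonneg_right (by positivity)
  have hup : absBinomial c₁ c₂ a b w ≤ C * u := by
    calc absBinomial c₁ c₂ a b w ≤ c₁ * u + c₂ * (u * ∏ h, M ^ (b h - a h)) :=
          add_le_add_right (mul_le_mul_of_nonneg_left hv h₂.le) _
      _ = C * u := by rw [hC]; ring
  have hut : ∏ h, |w h| ^ (a h * t) = u ^ t := by
    rw [hu, ← Real.finsetProd_rpow _ _ fun h _ => (pow_pos (hpos h) _).le]
    refine Finset.prod_congr rfl fun h _ => ?_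
    rw [Real.rpow_mul (hpos h).le, Real.rpow_natCast]
  have hut0 : 0 < u ^ t := Real.rpow_pos_of_pos hu0 t
  rw [hut, add_mul]
  rcases le_total 0 t with ht | ht
  · calc absBinomial c₁ c₂ a b w ^ t ≤ (C * u) ^ t :=
          Real.rpow_le_rpow (absBinomial_nonneg h₁ h₂ w) hup ht
      _ = C ^ t * u ^ t := Real.mul_rpow hC0.le hu0.le
      _ ≤ _ := le_add_of_nonneg_right (by positivity)
  · calc absBinomial c₁ c₂ a b w ^ t ≤ (c₁ * u) ^ t :=
          Real.rpow_le_rpow_of_nonpos (by positivity) hlow ht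
      _ = c₁ ^ t * u ^ t := Real.mul_rpow h₁.le hu0.le
      _ ≤ _ := le_add_of_nonneg_left (by positivity)

theorem integrableOn_absBinomial_rpow (h₁ : 0 < c₁) (h₂ : 0 < c₂) {a b : Fin d → ℕ}
    (hab : ∀ h, a h ≤ b h) {s : Fin d → ℝ} {t : ℝ} (ht : ∀ h, 0 < a h * t + s h) :
    IntegrableOn (fun w => absBinomial c₁ c₂ a b w ^ t * absMonomial s w) (cube d M) := by
  have hr : ∀ h, -1 < a h * t + (s h - 1) := fun h => by linarith [ht h]
  refine Integrable.mono' ((integrableOn_prod_abs_rpow M hr).const_mul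
    ((c₁ + c₂ * ∏ h, M ^ (b h - a h)) ^ t + c₁ ^ t))
    (((continuous_absBinomial c₁ c₂ a b).measurable.pow_const _).mul
      (measurable_absMonomial s)).aestronglyMeasurable ?_
  filter_upwards [ae_restrict_of_ae ae_forall_ne_zero, ae_restrict_mem (measurableSet_cube d M)]
    with w hw0 hw
  rw [Real.norm_of_nonneg (mul_nonneg (Real.rpow_nonneg (absBinomial_nonneg h₁ h₂ w) _)
    (absMonomial_nonneg s w))]
  have e : ∏ h, |w h| ^ (a h * t + (s h - 1)) = (∏ h, |w h| ^ (a h * t)) * absMonomial s w := by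
    rw [absMonomial, ← Finset.prod_mul_distrib]
    exact Finset.prod_congr rfl fun h _ => Real.rpow_add (abs_pos.2 (hw0 h)) _ _
  rw [e, ← mul_assoc]
  exact mul_le_mul_of_nonneg_right (absBinomial_rpow_le h₁ h₂ hab hw hw0 t) (absMonomial_nonneg s w)

theorem complexMGF_log_absBinomial_ofReal (h₁ : 0 < c₁) (h₂ : 0 < c₂) (a b : Fin d → ℕ)
    (s : Fin d → ℝ) (x : ℝ) :
    complexMGF (fun w => Real.log (absBinomial c₁ c₂ a b w)) (monomialMeasure s (cube d M)) x =
      (binomialIntegral M c₁ c₂ a b s x : ℂ) := by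
  rw [complexMGF_log (ae_absBinomial_pos h₁ h₂), binomialIntegral, ← integral_complex_ofReal]
  congr 1
  ext w
  rw [← Complex.ofReal_cpow (absBinomial_nonneg h₁ h₂ w), ← Complex.ofReal_mul]

/-- By proportionality the conditions a_h t + s_h > 0 reduce to the single one p t + r > 0. -/
theorem analyticOnNhd_complexMGF_stepDomain (h₁ : 0 < c₁) (h₂ : 0 < c₂) {a b : Fin d → ℕ}
    {σ : Fin d → ℝ} (hσ : ∀ h, 0 < σ h) {p q r : ℝ} (hpq : p ≤ q)
    (ha : ∀ h, (a h : ℝ) = p * σ h) (hb : ∀ h, (b h : ℝ) = q * σ h) :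
    AnalyticOnNhd ℂ (complexMGF (fun w => Real.log (absBinomial c₁ c₂ a b w))
      (monomialMeasure (fun h => r * σ h) (cube d M))) (stepDomain p q r 0) := by
  intro z hz
  refine analyticAt_complexMGF (mem_interior.2 ⟨{t | 0 < p * t + r}, fun t ht => ?_,
    isOpen_lt continuous_const (by fun_prop), ?_⟩)
  · rw [mem_integrableExpSet_log_iff (ae_absBinomial_pos h₁ h₂)]
    refine integrableOn_absBinomial_rpow h₁ h₂ (fun h => ?_) fun h => ?_
    · have : (a h : ℝ) ≤ b h := by
        rw [ha, hb]; exact mul_le_mul_of_nonneg_right hpq (hσ h).le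
      exact_mod_cast this
    · have := mul_pos ht (hσ h)
      rw [ha]; linarith
  · simpa [stepDomain] using hz

theorem binomialIntegral_extends_stepDomain (hext : BinomialIntegralsExtend M d) (hM : 0 < M)
    (h₁ : 0 < c₁) (h₂ : 0 < c₂) {a b : Fin (d + 1) → ℕ}
    {σ : Fin (d + 1) → ℝ} (hσ : ∀ h, 0 < σ h) {p q : ℝ} (hp : 0 ≤ p) (hpq : p < q)
    (ha : ∀ h, (a h : ℝ) = p * σ h) (hb : ∀ h, (b h : ℝ) = q * σ h) (N : ℕ) :
    ∀ r : ℝ, 0 < r →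
      ExtendsTo (stepDomain p q r N) (binomialIntegral M c₁ c₂ a b fun h => r * σ h) := by
  induction N with
  | zero =>
    exact fun r _ => ExtendsTo.of_analytic
      (analyticOnNhd_complexMGF_stepDomain (M := M) h₁ h₂ hσ hpq.le ha hb)
      fun x => complexMGF_log_absBinomial_ofReal h₁ h₂ a b _ x
  | succ N ih =>
    intro r hr
    have hs : ∀ h, 0 < r * σ h := fun h => mul_pos hr (hσ h)
    have hshift : (fun h => r * σ h + (b h : ℝ)) = fun h => (r + q) * σ h := by
      ext h; rw [hb]; ring
    have hE := hext.boundary hM h₁ h₂ 0 a b hs (stepDomain p q r (N + 1))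
    -- Replacing z by z - 1 and r by r + q adds q - p > 0 to the defining expression, which is the
    -- gain of one step.
    have hJ := ((ih (r + q) (by linarith)).comp_sub_one).mono
      (V := stepDomain p q r (N + 1)) fun z hz => by
        simp only [stepDomain, mem_ofPred_eq, Complex.sub_re, Complex.one_re, Nat.cast_add,
          Nat.cast_one] at hz ⊢
        linarith
    refine ((hE.sub ((ExtendsTo.affine _ (b 0 - a 0) 0).mul ((ExtendsTo.const c₂).mul hJ))).div
      (ExtendsTo.affine _ (a 0) (r * σ 0))).congr ?_
    filter_upwards [eventually_ge_atTop 1] with x hx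
    have h3 := binomialIntegralPart_relation hM h₁ h₂ 0 a b hs hx
    have h4 := binomialIntegralPart_eq_binomialIntegral M c₁ c₂ a b (fun h => r * σ h) x
    rw [hshift] at h4
    rw [div_eq_iff (affine_pos (hs 0) hx).ne', binomialIntegral_eq_add h₁ h₂ hs hx, ← h4,
      binomialBoundary, ← h3]
    ring

theorem binomialIntegral_extends_of_proportional (hext : BinomialIntegralsExtend M d) (hM : 0 < M)
    (h₁ : 0 < c₁) (h₂ : 0 < c₂) {a b : Fin (d + 1) → ℕ}
    {s : Fin (d + 1) → ℝ} (hs : ∀ h, 0 < s h) {p q : ℝ} (hp : 0 ≤ p) (hpq : p < q)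
    (ha : ∀ h, (a h : ℝ) = p * s h) (hb : ∀ h, (b h : ℝ) = q * s h) :
    ExtendsTo univ (binomialIntegral M c₁ c₂ a b s) := by
  have h3 := fun N => binomialIntegral_extends_stepDomain hext hM h₁ h₂ hs hp hpq ha hb N 1 one_pos
  have h4 := analyticOnNhd_complexMGF_stepDomain (M := M) (r := 1) h₁ h₂ hs hpq.le ha hb
  simp only [one_mul] at h3 h4
  have hre : ∀ N, stepDomain p q 1 N = Complex.re ⁻¹' {t | 0 < p * t + N * (q - p) + 1} :=
    fun N => rfl
  refine ExtendsTo.iUnion (U := stepDomain p q 1) (fun N K hNK z hz => ?_) (fun N => ?_) (fun N => ?_)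
    (fun z => ?_) ?_ h4
    (Eventually.of_forall fun x => complexMGF_log_absBinomial_ofReal h₁ h₂ a b _ x) h3
  · have : (N : ℝ) * (q - p) ≤ K * (q - p) :=
      mul_le_mul_of_nonneg_right (by exact_mod_cast hNK) (by linarith)
    simp only [stepDomain, mem_ofPred_eq] at hz ⊢
    linarith
  · exact isOpen_lt continuous_const (by fun_prop)
  · refine Convex.isPreconnected ?_
    rw [hre]
    refine Convex.is_linear_preimage (f := Complex.re) ?_ ⟨Complex.add_re, fun c z => by simp⟩
    intro x hx y hy α β hα hβ hαβ
    simp only [mem_ofPred_eq, smul_eq_mul] at hx hy ⊢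
    have : p * (α * x + β * y) + N * (q - p) + 1 = α * (p * x + N * (q - p) + 1) +
        β * (p * y + N * (q - p) + 1) := by linear_combination (-(N * (q - p) + 1)) * hαβ
    rw [this]
    rcases hα.eq_or_lt with h0 | h0
    · have : β = 1 := by linarith
      rw [← h0, this]; linarith
    · have := mul_pos h0 hx
      have := mul_nonneg hβ hy.le
      linarith
  · obtain ⟨N, hN⟩ := exists_nat_gt (-(p * z.re + 1) / (q - p))
    rw [div_lt_iff₀ (by linarith)] at hN
    exact ⟨N, by simp only [stepDomain, mem_ofPred_eq]; linarith⟩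
  · filter_upwards [eventually_ge_atTop 0] with x hx
    simp only [stepDomain, mem_ofPred_eq, Complex.ofReal_re, Nat.cast_zero, zero_mul]
    positivity

/-- Every binomial integral extends meromorphically to the whole plane. -/
theorem binomialIntegralsExtend (hM : 0 < M) (d : ℕ) : BinomialIntegralsExtend M d := by
  induction d with
  | zero => exact binomialIntegralsExtend_zero M
  | succ d ih =>
    intro c₁ c₂ a b s h₁ h₂ hs
    by_cases heq : ∃ i, a i = b i
    · obtain ⟨i, hi⟩ := heq
      exact binomialIntegral_extends_of_eq ih hM h₁ h₂ hs hi
    by_cases hdet : ∃ i k, (a i * b k - b i * a k : ℝ) ≠ 0 ∨ s k * (a i - b i) - s i * (a k - b k) ≠ 0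
    · obtain ⟨i, k, hik⟩ := hdet
      exact binomialIntegral_extends_of_det ih hM h₁ h₂ hs hik
    -- If all determinants vanish and no exponents agree, both exponent vectors are multiples of s.
    push Not at heq hdet
    have hs0 := (hs 0).ne'
    have hne : (a 0 : ℝ) - b 0 ≠ 0 := sub_ne_zero.2 (by exact_mod_cast heq 0)
    have hprop : ∀ h, (a h : ℝ) = a 0 / s 0 * s h ∧ (b h : ℝ) = b 0 / s 0 * s h := by
      intro h
      obtain ⟨e1, e2⟩ := hdet 0 h
      have e3 : (a 0 - b 0 : ℝ) * (s h * b 0 - s 0 * b h) = 0 := by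
        linear_combination (b 0 : ℝ) * e2 - s 0 * e1
      have e4 : s h * b 0 - s 0 * b h = 0 := (mul_eq_zero.1 e3).resolve_left hne
      constructor
      · field_simp; linarith
      · field_simp; linarith
    rcases lt_or_gt_of_ne (heq 0) with h | h
    · exact binomialIntegral_extends_of_proportional ih hM h₁ h₂ hs
        (div_nonneg (Nat.cast_nonneg _) (hs 0).le)
        (div_lt_div_of_pos_right (by exact_mod_cast h) (hs 0)) (fun h => (hprop h).1)
        fun h => (hprop h).2
    · rw [binomialIntegral_comm]
      exact binomialIntegral_extends_of_proportional ih hM h₂ h₁ hs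
        (div_nonneg (Nat.cast_nonneg _) (hs 0).le)
        (div_lt_div_of_pos_right (by exact_mod_cast h) (hs 0)) (fun h => (hprop h).2)
        fun h => (hprop h).1

/-- The zeta function of a non-negative binomial on a cube has a meromorphic continuation. -/
theorem exists_isMeromorphicContinuation {a : Fin d → Fin 2 → ℕ} {s : Fin d → ℝ}
    (hs : ∀ h, 0 < s h) (ha : IsNonnegSop a) (hM : 0 < M) :
    ∃ F : ℂ → ℂ, IsMeromorphicContinuation (sopZeta a s (cube d M)) F := by
  obtain ⟨F, hF, hFJ⟩ := binomialIntegralsExtend hM d 1 1 (fun h => a h 0) (fun h => a h 1) s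
    one_pos one_pos hs
  have hfun : absBinomial 1 1 (fun h => a h 0) (fun h => a h 1) = sopEval a := by
    ext w; rw [sopEval_eq_abs ha, absBinomial, one_mul, one_mul]
  set ζ := complexMGF (fun w => Real.log (sopEval a w)) (monomialMeasure s (cube d M)) with hζ
  have hFζ : ∀ᶠ x : ℝ in atTop, F x = ζ x := by
    filter_upwards [hFJ] with x hx
    rw [hx, ← complexMGF_log_absBinomial_ofReal one_pos one_pos, hfun]
  have hcpt := isCompact_cube d M
  obtain ⟨B, hB⟩ := exists_log_sopEval_le two_pos ha hcpt s
  have hζan : AnalyticOnNhd ℂ ζ {z : ℂ | 0 < z.re} := fun z hz =>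
    analyticAt_complexMGF (mem_interior_integrableExpSet_of_lt (aemeasurable_log_sopEval a _) hB
      (zero_mem_integrableExpSet hs hcpt _) hz)
  obtain ⟨x, hx, hfreq⟩ := frequently_nhdsNE_of_eventually_atTop hFζ (eventually_gt_atTop 0)
  -- The normal form turns equality of punctured germs into equality at every point with Re z > 0.
  refine ⟨toMeromorphicNFOn F univ, fun z =>
    (meromorphicNFOn_toMeromorphicNFOn F univ (mem_univ z)).meromorphicAt, fun z hz => ?_⟩
  have h1 : toMeromorphicNFOn F univ =ᶠ[𝓝[≠] z] ζ :=
    (hF.toMeromorphicNFOn_eq_self_on_nhdsNE (mem_univ z)).trans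
      ((hF.mono_set (subset_univ _)).eventuallyEq_of_frequently_eq hζan.meromorphicOn
        (isPreconnected_re_gt 0) (x := (x : ℂ)) (by simpa using hx) hfreq hz)
  rw [MeromorphicNFAt.eventuallyEq_nhdsNE_iff_eventuallyEq_nhds
    (meromorphicNFOn_toMeromorphicNFOn F univ (mem_univ z)) (hζan z hz).meromorphicNFAt] at h1
  rw [h1.eq_of_nhds, hζ, complexMGF_log (ae_sopEval_pos two_pos ha hcpt)]
  rfl

end Recursion

/-! ### The main theorem -/

theorem mainTheorem1 {d : ℕ} (hd : 0 < d) (s : Fin d → ℝ) (hs : ∀ h, 0 < s h) :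
    (∀ (n : ℕ), 0 < n → ∀ a : Fin d → Fin n → ℕ, IsNonnegSop a →
      ∃ M₀ : ℝ, 0 < M₀ ∧ ∀ W : Set (Fin d → ℝ), IsCompact W → cube d M₀ ⊆ W →
        (∀ z : ℂ, 0 < z.re → IntegrableOn (zetaIntegrand a s z) W) ∧
        ∀ F : ℂ → ℂ, IsMeromorphicContinuation (sopZeta a s W) F →
          ∃ lam : ℝ≥0∞, IsLargestPole F lam ∧
            ∃ β : ℝ, IsGreatest (simplexValues a s) β ∧ ENNReal.ofReal β ≤ 1 / lam) ∧
    (∀ a : Fin d → Fin 2 → ℕ, IsNonnegSop a →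
      ∃ M₀ : ℝ, 0 < M₀ ∧
        (∀ M : ℝ, M₀ ≤ M → ∃ F : ℂ → ℂ, IsMeromorphicContinuation (sopZeta a s (cube d M)) F) ∧
        ∀ W : Set (Fin d → ℝ), IsCompact W → cube d M₀ ⊆ W →
          ∀ F : ℂ → ℂ, IsMeromorphicContinuation (sopZeta a s W) F →
            ∃ lam : ℝ≥0∞, IsLargestPole F lam ∧
              ∃ β : ℝ, IsGreatest (simplexValues a s) β ∧ IsGreatest (binomialValues a s) β ∧
                1 / lam = ENNReal.ofReal β) := by
  -- M₀ = 1 suffices: the boxes of the lower bound lie in [-1, 1]^d, and the upper bound holds on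
  -- every compact set.
  refine ⟨fun n hn a ha => ⟨1, one_pos, fun W hW hcube => ⟨fun z hz =>
    integrableOn_zetaIntegrand hn ha hs hW hz, fun F hF => ?_⟩⟩, fun a ha => ⟨1, one_pos,
    fun M hM => exists_isMeromorphicContinuation hs ha (one_pos.trans_le hM),
    fun W hW hcube F hF => ?_⟩⟩
  · obtain ⟨lam, hlam, hb⟩ := exists_isLargestPole_sopZeta hn ha hs hW hF
    obtain ⟨β, hβ⟩ := exists_isGreatest_simplexValues hd hn a s
    exact ⟨lam, hlam, β, hβ,
      ofReal_le_one_div_of_isLargestPole hn hs ha hcube hβ.1 fun b hb0 => (hb b hb0).2⟩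
  · obtain ⟨lam, hlam, hb⟩ := exists_isLargestPole_sopZeta two_pos ha hs hW hF
    obtain ⟨β, hβ, hβ', θ, hθ, hle⟩ := exists_isGreatest_binomialValues hd hs a
    exact ⟨lam, hlam, β, hβ, hβ', le_antisymm
      (one_div_le_ofReal_of_isLargestPole ha hW hs hθ hle fun b hb0 => (hb b hb0).1)
      (ofReal_le_one_div_of_isLargestPole two_pos hs ha hcube hβ.1 fun b hb0 => (hb b hb0).2)⟩
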